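/- Let $\mathcal M$ be the set of finite positive Borel measures on $\mathbb R$ with finite first moment. For $\mu,\nu\in\mathcal M$ write $\mu\le_c\nu$ if $\int\varphi\,d\mu\le\int\varphi\,d\nu$ for every convex $\varphi:\mathbb R\to\mathbb R$, and let the shadow $S^\nu(\mu)$ be the smallest element, with respect to $\le_c$, of $\{\eta:\ \mu\le_c\eta,\ \eta\le\nu\}$, where $\eta\le\nu$ means $\eta(A)\le\nu(A)$ for every Borel set $A$. A curve $u\mapsto\theta_{[0,u]}$ in $\mathcal M$ has right derivative $m\in\mathcal M$ at $u_0$ if $\lim_{h\downarrow0}h^{-1}\left(\int f\,d\theta_{[0,u_0+h]}-\int f\,d\theta_{[0,u_0]}\right)=\int f\,dm$ for every continuous $f:\mathbb R\to\mathbb R$ with $\sup_x|f(x)|/(1+|x|)<\infty$. For a closed set $T\subset\mathbb R$ and $x\in[\inf T,\sup T]$ put $P_T(x,\cdot)=\delta_x$ if $x\in T$ and, if $x\notin T$, $$P_T(x,\cdot)=\frac{x^+-x}{x^+-x^-}\,\delta_{x^-}+\frac{x-x^-}{x^+-x^-}\,\delta_{x^+},\qquad x^-=\sup(T\cap(-\infty,x]),\quad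 x^+=\inf(T\cap[x,\infty));$$ for $m\in\mathcal M$ with $\mathrm{spt}(m)\subset[\inf T,\sup T]$ the hitting projection of $m$ in $T$ is $mP_T=\int P_T(x,\cdot)\,dm(x)$. Here $[\inf T,\sup T]$ denotes the set of real numbers $x$ with $\inf T\le x\le\sup T$, where the infimum and supremum are taken in $[-\infty,\infty]$. Let $\mu,\nu\in\mathcal M$ be probability measures with $\mu\le_c\nu$, and let $\hat\mu$ be a probability measure on $[0,1]\times\mathbb R$ whose first marginal is Lebesgue measure on $[0,1]$ and whose second marginal is $\mu$. For $u\in[0,1]$ set $\mu_{[0,u]}(A)=\hat\mu([0,u]\times A)$ and $\nu_{[0,u]}=S^\nu(\mu_{[0,u]})$. Let $u_0\in[0,1)$, suppose that $u\mapsto\mu_{[0,u]}$ has right derivative $\mu_{u_0}\in\mathcal M$ at $u_0$, and let $T=\mathrm{spt}(\nu-\nu_{[0,u_0]})$. Then $\mathrm{spt}(\mu_{u_0})\subset[\inf T,\sup T]$, and $u\mapsto\nu_{[0,u]}$ has a right derivative at $u_0$, which is equal to the hitting projection $\mu_{u_0}P_T$. -/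

import Mathlib

open MeasureTheory Set Filter Topology

namespace ShadowCoupling

/-- The class `𝓜` of positive (finite) measures on `ℝ` with finite first moment. -/
def FiniteFirstMoment (μ : Measure ℝ) : Prop :=
  IsFiniteMeasure μ ∧ Integrable (fun x : ℝ => x) μ

/-- The convex order `μ ≤_c ν` on `𝓜`. A convex function is bounded below by an affine one, so its
integral against an element of `𝓜` is a real number or `+∞`; it suffices to compare the integrals
of the convex functions for which both are finite, since every convex function is an increasing
limit of maxima of finitely many affine functions. -/
def ConvexLE (μ ν : Measure ℝ) : Prop :=
  FiniteFirstMoment μ ∧ FiniteFirstMoment ν ∧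
    ∀ φ : ℝ → ℝ, ConvexOn ℝ univ φ → Integrable φ μ → Integrable φ ν →
      ∫ x, φ x ∂μ ≤ ∫ x, φ x ∂ν

/-- `η` is the smallest measure in convex order among the measures `η'` with
`μ ≤_c η'` and `η' ≤ ν`. -/
structure IsShadow (ν μ η : Measure ℝ) : Prop where
  convexLE : ConvexLE μ η
  le : η ≤ ν
  minimal : ∀ η' : Measure ℝ, ConvexLE μ η' → η' ≤ ν → ConvexLE η η'

open Classical in
/-- The shadow `S^ν(μ)` of `μ` in `ν` (the value is `0` if there is no shadow). -/
noncomputable def shadow (ν μ : Measure ℝ) : Measure ℝ :=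
  if h : ∃ η, IsShadow ν μ η then h.choose else 0

/-- `θhat` belongs to `Π(λ, θ)`, where `λ` is Lebesgue measure on `[0,1]`. -/
def IsLift (θhat : Measure (ℝ × ℝ)) (θ : Measure ℝ) : Prop :=
  θhat.map Prod.fst = volume.restrict (Icc (0 : ℝ) 1) ∧ θhat.map Prod.snd = θ

/-- The primitive curve `θ_{[0,u]}(A) = θhat([0,u] × A)`. -/
noncomputable def primitiveCurve (θhat : Measure (ℝ × ℝ)) (u : ℝ) : Measure ℝ :=
  (θhat.restrict (Icc 0 u ×ˢ univ)).map Prod.snd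

/-- The curve of measures `u ↦ θ u` has right derivative `m ∈ 𝓜` at `u₀` with respect to the topology
`𝓣₁`: for every continuous `f` of at most linear growth,
`h⁻¹ (∫ f dθ(u₀+h) - ∫ f dθ(u₀)) → ∫ f dm` as `h ↓ 0`. -/
def HasRightDerivative (θ : ℝ → Measure ℝ) (m : Measure ℝ) (u₀ : ℝ) : Prop :=
  FiniteFirstMoment m ∧
    ∀ f : ℝ → ℝ, Continuous f → (∃ C : ℝ, ∀ x, |f x| ≤ C * (1 + |x|)) →
      HasDerivWithinAt (fun u => ∫ x, f x ∂(θ u)) (∫ x, f x ∂m) (Ici u₀) u₀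

/-- The infimum of `T` in `[-∞, ∞]`. -/
noncomputable def einf (T : Set ℝ) : EReal := sInf (Real.toEReal '' T)

/-- The supremum of `T` in `[-∞, ∞]`. -/
noncomputable def esup (T : Set ℝ) : EReal := sSup (Real.toEReal '' T)

/-- The set `[inf T, sup T]` of real numbers. -/
def hull (T : Set ℝ) : Set ℝ := {x : ℝ | einf T ≤ (x : EReal) ∧ (x : EReal) ≤ esup T}

/-- The closed set `T* = ]-∞, inf T] ∪ closure T ∪ [sup T, ∞[`, unbounded in both directions. -/
def extendSet (T : Set ℝ) : Set ℝ :=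
  {x : ℝ | (x : EReal) ≤ einf T} ∪ closure T ∪ {x : ℝ | esup T ≤ (x : EReal)}

open Classical in
/-- The Kellerer dilation `P_T(x, ·)`, for a closed set `T` unbounded in both directions. With
`x⁻ = sup (T ∩ ]-∞, x])` and `x⁺ = inf (T ∩ [x, ∞[)`, it is `δ_x` if `x ∈ T`, and otherwise the law
on `{x⁻, x⁺}` with barycenter `x`. -/
noncomputable def kellererKernel (T : Set ℝ) (x : ℝ) : Measure ℝ :=
  if x ∈ T then Measure.dirac x
  else
    ENNReal.ofReal ((sInf (T ∩ Ici x) - x) / (sInf (T ∩ Ici x) - sSup (T ∩ Iic x))) •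
        Measure.dirac (sSup (T ∩ Iic x)) +
      ENNReal.ofReal ((x - sSup (T ∩ Iic x)) / (sInf (T ∩ Ici x) - sSup (T ∩ Iic x))) •
        Measure.dirac (sInf (T ∩ Ici x))

/-- The hitting projection `μ P_T`, that is `A ↦ ∫ P_{T*}(x, A) dμ(x)`. On `[inf T, sup T]`, where `μ`
is meant to be carried, `P_{T*}` is given by the formula for `P_T`. -/
noncomputable def hittingProjection (μ : Measure ℝ) (T : Set ℝ) : Measure ℝ :=
  μ.bind (kellererKernel (extendSet T))

end ShadowCoupling

namespace ShadowCoupling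

/-! Everything is expressed through the potential function `put μ t` = ∫ (t - y)⁺ dμ(y), a convex
function whose slope is the distribution function of μ. Between measures of equal mass and
barycenter, convex order is the pointwise order of potentials (`convexLE_of_put_le`), and η ≤ ν
means that `put ν - put η` is convex. Hence admissible η correspond to convex minorants of `put ν -
put μ`, and the shadow corresponds to the largest one: put S^ν(μ) = put ν - env(put ν - put μ)
(`exists_isShadow`). From env(env V - U) = env(V - U) it follows that the increment of u ↦ ν_{[0,u]}
after u₀ is the shadow η_u of the increment σ_u of μ_{[0,u]} in the remainder ν' = ν - ν_{[0,u₀]}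
(`exists_shadow_add`).

It remains to find the limit of η_u / (u - u₀), given that σ_u / (u - u₀) tends to m = μ_{u₀} and
the mass of σ_u tends to 0. At t ∈ T = spt ν', every neighbourhood of t eventually carries more mass
of ν' than σ_u has, so the potentials of σ_u and η_u at t differ by o(u - u₀) (`sub_envelope_le`).
At points t ≤ inf T or t ≥ sup T they agree exactly. In the gaps of T the potential of η_u is
affine, because η_u is carried by T. The hitting projection m P_T has these same properties relative
to m: its potential equals that of m on the extended set T* and is affine in the gaps. So the
rescaled potentials converge everywhere; mass and barycenter converge too, which yields all
continuous test functions of linear growth (`tendsto_integral_of_tendsto_put`). The support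
statement follows by passing to the limit in the vanishing puts and calls of σ_u outside the hull of
T. -/

/-! ### Convex functions and convex envelopes -/

/-- Apply the hypothesis to the chord of `E` over `[p, q]`. Comparison with lines passes through
suprema and gluing without handling weights. -/
theorem convexOn_of_le_affine {E : ℝ → ℝ}
    (h : ∀ p q x s c : ℝ, p < x → x < q → E p ≤ s * p + c → E q ≤ s * q + c → E x ≤ s * x + c) :
    ConvexOn ℝ univ E := by
  refine LinearOrder.convexOn_of_lt convex_univ ?_
  intro p _ q _ hpq a b ha hb hab
  simp only [smul_eq_mul]
  obtain rfl : a = 1 - b := by linarith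
  have hne : q - p ≠ 0 := by linarith
  have h1 := h p q ((1 - b) * p + b * q) ((E q - E p) / (q - p))
    (E p - (E q - E p) / (q - p) * p) (by nlinarith) (by nlinarith) (by linarith)
    (le_of_eq (by field_simp; ring))
  refine h1.trans (le_of_eq ?_)
  field_simp
  ring

theorem _root_.ConvexOn.le_affine {φ : ℝ → ℝ} (hφ : ConvexOn ℝ univ φ) {p q x s c : ℝ}
    (hpx : p ≤ x) (hxq : x ≤ q) (hp : φ p ≤ s * p + c) (hq : φ q ≤ s * q + c) :
    φ x ≤ s * x + c := by
  have hlin : ConcaveOn ℝ univ (fun t : ℝ => s * t + c) := by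
    refine ⟨convex_univ, ?_⟩
    intro a _ b _ u v _ _ huv
    simp only [smul_eq_mul]
    refine le_of_eq ?_
    linear_combination c * huv
  have h := (hφ.sub hlin).le_max_of_mem_Icc (mem_univ p) (mem_univ q) ⟨hpx, hxq⟩
  simp only [Pi.sub_apply] at h
  have : max (φ p - (s * p + c)) (φ q - (s * q + c)) ≤ 0 := max_le (by linarith) (by linarith)
  linarith

theorem convexOn_affine (s c : ℝ) : ConvexOn ℝ univ (fun t : ℝ => s * t + c) :=
  convexOn_of_le_affine (by
    intro p q x s' c' hp hq h1 h2
    nlinarith [mul_nonneg (sub_nonneg.2 hp.le) (sub_nonneg.2 h2),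
      mul_nonneg (sub_nonneg.2 hq.le) (sub_nonneg.2 h1)])

/-- Gluing: replacing a convex function on `[a, b]` by its maximum with another convex function
that does not exceed it at `a` and `b` preserves convexity. -/
theorem convexOn_glue {C D : ℝ → ℝ} (hC : ConvexOn ℝ univ C) (hD : ConvexOn ℝ univ D) {a b : ℝ}
    (ha : D a ≤ C a) (hb : D b ≤ C b) :
    ConvexOn ℝ univ (fun t => if t ∈ Icc a b then max (C t) (D t) else C t) := by
  have hCE : ∀ t, C t ≤ if t ∈ Icc a b then max (C t) (D t) else C t := by
    intro t
    split_ifs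
    · exact le_max_left _ _
    · exact le_rfl
  apply convexOn_of_le_affine
  intro p q x s c hpx hxq hp hq
  have hCp := (hCE p).trans hp
  have hCq := (hCE q).trans hq
  have hCx := hC.le_affine hpx.le hxq.le hCp hCq
  split_ifs with hx
  -- `D` is compared with the line on `[p, q] ∩ [a, b]` only. At an endpoint cut off to `a` or `b`,
  -- `D ≤ C` there and `C` lies below the line.
  · refine max_le hCx (hD.le_affine (p := max p a) (q := min q b) (max_le hpx.le hx.1)
      (le_min hxq.le hx.2) ?_ ?_)
    · rcases le_total a p with h | h
      · rw [max_eq_left h]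
        rw [if_pos ⟨h, hpx.le.trans hx.2⟩] at hp
        exact (le_max_right _ _).trans hp
      · rw [max_eq_right h]
        exact ha.trans (hC.le_affine h (hx.1.trans hxq.le) hCp hCq)
    · rcases le_total q b with h | h
      · rw [min_eq_left h]
        rw [if_pos ⟨hx.1.trans hxq.le, h⟩] at hq
        exact (le_max_right _ _).trans hq
      · rw [min_eq_right h]
        exact hb.trans (hC.le_affine (hpx.le.trans hx.2) h hCp hCq)
  · exact hCx

/-- The largest convex minorant of `V` (meaningful if `V` has a convex minorant). -/
noncomputable def envelope (V : ℝ → ℝ) (x : ℝ) : ℝ :=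
  sSup {y | ∃ c : ℝ → ℝ, ConvexOn ℝ univ c ∧ c ≤ V ∧ y = c x}

theorem le_envelope {V c : ℝ → ℝ} (hc : ConvexOn ℝ univ c) (hcV : c ≤ V) : c ≤ envelope V := by
  intro x
  refine le_csSup ⟨V x, ?_⟩ ⟨c, hc, hcV, rfl⟩
  rintro _ ⟨c', _, h, rfl⟩
  exact h x

/-- The minorant `c` keeps the supremum from being over the empty set, where `sSup` has the default
value `0`. -/
theorem envelope_apply_le {V c : ℝ → ℝ} (hc : ConvexOn ℝ univ c) (hcV : c ≤ V) {x b : ℝ}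
    (h : ∀ c : ℝ → ℝ, ConvexOn ℝ univ c → c ≤ V → c x ≤ b) : envelope V x ≤ b := by
  refine csSup_le ⟨_, c, hc, hcV, rfl⟩ ?_
  rintro _ ⟨c', hc', h', rfl⟩
  exact h c' hc' h'

theorem envelope_le {V c : ℝ → ℝ} (hc : ConvexOn ℝ univ c) (hcV : c ≤ V) : envelope V ≤ V :=
  fun x => envelope_apply_le hc hcV fun _ _ h => h x

theorem convexOn_envelope {V c : ℝ → ℝ} (hc : ConvexOn ℝ univ c) (hcV : c ≤ V) :
    ConvexOn ℝ univ (envelope V) := by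
  apply convexOn_of_le_affine
  intro p q x s d hp hq h1 h2
  exact envelope_apply_le hc hcV fun c' hc' h' =>
    hc'.le_affine hp.le hq.le ((le_envelope hc' h' p).trans h1) ((le_envelope hc' h' q).trans h2)

/-- If `g` and `f` are convex, then so is the difference of `g` and the convex envelope of
`g - f`. -/
theorem convexOn_sub_envelope {g f c : ℝ → ℝ} (hg : ConvexOn ℝ univ g) (hf : ConvexOn ℝ univ f)
    (hc : ConvexOn ℝ univ c) (hcV : c ≤ g - f) : ConvexOn ℝ univ (g - envelope (g - f)) := by
  have hE := convexOn_envelope hc hcV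
  have hEV := envelope_le hc hcV
  apply convexOn_of_le_affine
  intro p q x s d hp hq h1 h2
  simp only [Pi.sub_apply] at h1 h2 ⊢
  -- Let ℓ be the line and E the envelope. At `p` and `q`, g - ℓ ≤ E ≤ g - f, hence f ≤ ℓ there and,
  -- by convexity, on `[p, q]`. So E glued with max(E, g - ℓ) on `[p, q]` is still a convex minorant
  -- of g - f, and maximality of E gives g - ℓ ≤ E at `x`.
  have hD : ConvexOn ℝ univ (fun t => g t - (s * t + d)) := by
    have := hg.add (convexOn_affine (-s) (-d))
    refine this.congr fun t _ => ?_
    simp only [Pi.add_apply]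
    ring
  have hG := convexOn_glue hE hD (a := p) (b := q) (by linarith) (by linarith)
  have hle : (fun t => if t ∈ Icc p q then max (envelope (g - f) t) (g t - (s * t + d))
      else envelope (g - f) t) ≤ g - f := by
    intro t
    dsimp only
    split_ifs with ht
    · refine max_le (hEV t) ?_
      have hfp := hEV p
      have hfq := hEV q
      simp only [Pi.sub_apply] at hfp hfq ⊢
      have := hf.le_affine (s := s) (c := d) ht.1 ht.2 (by linarith) (by linarith)
      linarith
    · exact hEV t
  have h := le_envelope hG hle x
  dsimp only at h
  rw [if_pos ⟨hp.le, hq.le⟩] at h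
  linarith [(le_max_right (envelope (g - f) x) _).trans h]

/-- Both functions have the same convex minorants: if `c` is convex and `c + U ≤ V`, then `c + U`,
being convex, already lies below `envelope V`. Additivity of shadows rests on this. -/
theorem envelope_envelope_sub {V U c : ℝ → ℝ} (hU : ConvexOn ℝ univ U)
    (hc : ConvexOn ℝ univ c) (hcV : c ≤ V - U) :
    envelope (envelope V - U) = envelope (V - U) := by
  have hcU : ConvexOn ℝ univ (c + U) := hc.add hU
  have hcUV : c + U ≤ V := fun x => by have := hcV x; simp at this ⊢; linarith
  have hEV := envelope_le hcU hcUV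
  have hc' : c ≤ envelope V - U := fun x => by
    have := le_envelope hcU hcUV x
    simp at this ⊢
    linarith
  apply le_antisymm
  · refine le_envelope (convexOn_envelope hc hc') fun x => ?_
    have h1 := envelope_le hc hc' x
    have h2 := hEV x
    simp at h1 ⊢
    linarith
  · refine le_envelope (convexOn_envelope hc hcV) fun x => ?_
    have h1 : envelope (V - U) + U ≤ V := fun y => by
      have := envelope_le hc hcV y
      simp at this ⊢
      linarith
    have h2 := le_envelope ((convexOn_envelope hc hcV).add hU) h1 x
    simp at h2 ⊢
    linarith

/-! ### Slope functions and curvature measures -/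

/-- `F` is a slope function of `φ`: the increments of `φ` are those of a function whose derivative
is the monotone function `F`. -/
def IsSlope (F φ : ℝ → ℝ) : Prop :=
  ∀ x z, x < z → F x * (z - x) ≤ φ z - φ x ∧ φ z - φ x ≤ F z * (z - x)

theorem IsSlope.add {F G φ ψ : ℝ → ℝ} (h : IsSlope F φ) (h' : IsSlope G ψ) :
    IsSlope (fun x => F x + G x) (φ + ψ) := by
  intro x z hxz
  obtain ⟨h1, h2⟩ := h x z hxz
  obtain ⟨h3, h4⟩ := h' x z hxz
  constructor <;> simp only [Pi.add_apply] <;> nlinarith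

/-- For z > x the difference quotient lies between `F x` and `G z`; right-continuity of `G` lets z ↓
x. So right-continuous slopes are unique. -/
theorem IsSlope.le {F : ℝ → ℝ} {G : StieltjesFunction ℝ} {φ : ℝ → ℝ} (h : IsSlope F φ)
    (h' : IsSlope G φ) (x : ℝ) : F x ≤ G x := by
  have hG : Tendsto G (𝓝[>] x) (𝓝 (G x)) :=
    ((G.right_continuous x).mono Ioi_subset_Ici_self)
  refine ge_of_tendsto hG ?_
  filter_upwards [self_mem_nhdsWithin] with z hz
  have hz' : 0 < z - x := sub_pos.2 hz
  exact le_of_mul_le_mul_right ((h x z hz).1.trans (h' x z hz).2) hz'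

theorem IsSlope.unique {F G : StieltjesFunction ℝ} {φ : ℝ → ℝ} (h : IsSlope F φ)
    (h' : IsSlope G φ) : F = G :=
  StieltjesFunction.ext fun x => le_antisymm (h.le h' x) (h'.le h x)

theorem _root_.ConvexOn.continuous_of_univ {φ : ℝ → ℝ} (hφ : ConvexOn ℝ univ φ) : Continuous φ :=
  continuousOn_univ.1 (hφ.continuousOn isOpen_univ)

/-- The right derivative satisfies both bounds. Replacing it by its right limits can only increase
it, which preserves the upper bound; the lower one survives by continuity of `φ`. -/
theorem exists_isSlope {φ : ℝ → ℝ} (hφ : ConvexOn ℝ univ φ) :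
    ∃ F : StieltjesFunction ℝ, IsSlope F φ := by
  have hmono : Monotone (fun x => derivWithin φ (Ioi x) x) := by
    have := hφ.monotoneOn_rightDeriv
    rw [interior_univ] at this
    exact monotoneOn_univ.1 this
  have hlow : ∀ x z, x < z → derivWithin φ (Ioi x) x * (z - x) ≤ φ z - φ x := by
    intro x z hxz
    have h := hφ.rightDeriv_le_slope_of_mem_interior (x := x) (y := z) (by simp) (mem_univ z) hxz
    rw [slope_def_field, le_div_iff₀ (sub_pos.2 hxz)] at h
    exact h
  have hup : ∀ x z, x < z → φ z - φ x ≤ derivWithin φ (Ioi z) z * (z - x) := by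
    intro x z hxz
    have h := (hφ.slope_le_leftDeriv_of_mem_interior (x := x) (y := z) (mem_univ x) (by simp)
      hxz).trans (hφ.leftDeriv_le_rightDeriv_of_mem_interior (by simp))
    rw [slope_def_field, div_le_iff₀ (sub_pos.2 hxz)] at h
    exact h
  refine ⟨hmono.stieltjesFunction, fun x z hxz => ⟨?_, ?_⟩⟩
  · rw [hmono.stieltjesFunction_eq]
    have h1 := hmono.tendsto_rightLim x
    have hid : Tendsto (fun w : ℝ => w) (𝓝[>] x) (𝓝 x) := tendsto_nhdsWithin_of_tendsto_nhds tendsto_id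
    have hφc : Tendsto φ (𝓝[>] x) (𝓝 (φ x)) :=
      tendsto_nhdsWithin_of_tendsto_nhds hφ.continuous_of_univ.continuousAt
    refine le_of_tendsto_of_tendsto (h1.mul (tendsto_const_nhds.sub hid))
      ((tendsto_const_nhds (x := φ z)).sub hφc) ?_
    filter_upwards [Ioo_mem_nhdsGT hxz] with w hw
    exact hlow w z hw.2
  · refine (hup x z hxz).trans (mul_le_mul_of_nonneg_right ?_ (sub_pos.2 hxz).le)
    rw [hmono.stieltjesFunction_eq]
    exact hmono.le_rightLim le_rfl

theorem IsSlope.hasDerivWithinAt {F : StieltjesFunction ℝ} {φ : ℝ → ℝ} (h : IsSlope F φ) (x : ℝ) :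
    HasDerivWithinAt φ (F x) (Ioi x) x := by
  rw [hasDerivWithinAt_iff_tendsto_slope' (by simp)]
  have hF : Tendsto F (𝓝[>] x) (𝓝 (F x)) :=
    ((F.right_continuous x).mono Ioi_subset_Ici_self)
  refine tendsto_of_tendsto_of_tendsto_of_le_of_le' tendsto_const_nhds hF ?_ ?_
  · filter_upwards [self_mem_nhdsWithin] with z hz
    rw [slope_def_field, le_div_iff₀ (sub_pos.2 hz)]
    exact (h x z hz).1
  · filter_upwards [self_mem_nhdsWithin] with z hz
    rw [slope_def_field, div_le_iff₀ (sub_pos.2 hz)]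
    exact (h x z hz).2

theorem IsSlope.integral_eq {F : StieltjesFunction ℝ} {φ : ℝ → ℝ} (hφ : ConvexOn ℝ univ φ)
    (h : IsSlope F φ) {a b : ℝ} (hab : a ≤ b) : ∫ s in a..b, F s = φ b - φ a :=
  intervalIntegral.integral_eq_sub_of_hasDeriv_right_of_le hab
    hφ.continuous_of_univ.continuousOn (fun x _ => h.hasDerivWithinAt x)
    F.mono.intervalIntegrable

/-- Two convex functions with the same curvature measure differ by an affine function. -/
theorem exists_affine_of_measure_eq {F G : StieltjesFunction ℝ} {φ ψ : ℝ → ℝ}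
    (hφ : ConvexOn ℝ univ φ) (hψ : ConvexOn ℝ univ ψ) (h : IsSlope F φ) (h' : IsSlope G ψ)
    (hFG : F.measure = G.measure) : ∃ s c : ℝ, ∀ x, φ x = ψ x + (s * x + c) := by
  have hinc : ∀ a b, a ≤ b → F b - F a = G b - G a := by
    intro a b hab
    have := congrArg (fun m => (m (Ioc a b)).toReal) hFG
    simp only [StieltjesFunction.measure_Ioc] at this
    rwa [ENNReal.toReal_ofReal (sub_nonneg.2 (F.mono hab)),
      ENNReal.toReal_ofReal (sub_nonneg.2 (G.mono hab))] at this
  have hF : ∀ x, F x = G x + (F 0 - G 0) := by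
    intro x
    rcases le_total 0 x with h0 | h0
    · linarith [hinc 0 x h0]
    · linarith [hinc x 0 h0]
  have hint : ∀ a b, a ≤ b → φ b - φ a = ψ b - ψ a + (F 0 - G 0) * (b - a) := by
    intro a b hab
    rw [← h.integral_eq hφ hab, ← h'.integral_eq hψ hab]
    rw [intervalIntegral.integral_congr (g := fun s => G s + (F 0 - G 0)) (fun s _ => hF s),
      intervalIntegral.integral_add G.mono.intervalIntegrable (by simp),
      intervalIntegral.integral_const, smul_eq_mul]
    ring
  refine ⟨F 0 - G 0, φ 0 - ψ 0, fun x => ?_⟩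
  rcases le_total 0 x with h0 | h0
  · linarith [hint 0 x h0]
  · linarith [hint x 0 h0]

/-! ### Finite first moments and potential functions -/

theorem FiniteFirstMoment.add {μ ν : Measure ℝ} (hμ : FiniteFirstMoment μ)
    (hν : FiniteFirstMoment ν) : FiniteFirstMoment (μ + ν) := by
  have := hμ.1
  have := hν.1
  exact ⟨inferInstance, hμ.2.add_measure hν.2⟩

theorem FiniteFirstMoment.mono {μ ν : Measure ℝ} (hν : FiniteFirstMoment ν) (h : μ ≤ ν) :
    FiniteFirstMoment μ := by
  have := hν.1
  exact ⟨isFiniteMeasure_of_le ν h, hν.2.mono_measure h⟩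

theorem FiniteFirstMoment.smul {μ : Measure ℝ} (hμ : FiniteFirstMoment μ) (a : ℝ) :
    FiniteFirstMoment (ENNReal.ofReal a • μ) := by
  have := hμ.1
  exact ⟨μ.smul_finite ENNReal.ofReal_ne_top, hμ.2.smul_measure ENNReal.ofReal_ne_top⟩

/-- A continuous function of at most linear growth is integrable. -/
theorem FiniteFirstMoment.integrable {μ : Measure ℝ} (hμ : FiniteFirstMoment μ) {f : ℝ → ℝ}
    (hf : Continuous f) {C : ℝ} (hC : ∀ x, |f x| ≤ C * (1 + |x|)) : Integrable f μ := by
  have := hμ.1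
  have hb : Integrable (fun x : ℝ => C * (1 + |x|)) μ :=
    ((integrable_const (1 : ℝ)).add hμ.2.abs).const_mul C
  exact hb.mono' hf.aestronglyMeasurable (Eventually.of_forall hC)

theorem linear_growth_put (t x : ℝ) : |max (t - x) 0| ≤ (1 + |t|) * (1 + |x|) := by
  have h1 : max (t - x) 0 ≤ |t| + |x| :=
    max_le (by linarith [le_abs_self t, neg_abs_le x]) (by positivity)
  rw [abs_of_nonneg (le_max_right _ _)]
  nlinarith [abs_nonneg t, abs_nonneg x]

/-- The potential function `t ↦ ∫ (t - y)⁺ dμ(y)`. -/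
noncomputable def put (μ : Measure ℝ) (t : ℝ) : ℝ := ∫ y, max (t - y) 0 ∂μ

theorem FiniteFirstMoment.integrable_put {μ : Measure ℝ} (hμ : FiniteFirstMoment μ) (t : ℝ) :
    Integrable (fun y => max (t - y) 0) μ :=
  hμ.integrable (by fun_prop) (linear_growth_put t)

theorem FiniteFirstMoment.integrable_call {μ : Measure ℝ} (hμ : FiniteFirstMoment μ) (t : ℝ) :
    Integrable (fun y => max (y - t) 0) μ := by
  have := hμ.1
  have h : (fun y => max (y - t) 0) = fun y => max (t - y) 0 + (y - t) := by
    funext y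
    rcases le_total y t with h | h
    · rw [max_eq_right (by linarith), max_eq_left (by linarith)]; ring
    · rw [max_eq_left (by linarith), max_eq_right (by linarith)]; ring
  rw [h]
  exact (hμ.integrable_put t).add (hμ.2.sub (integrable_const t))

/-- Put-call parity, (y - t)⁺ = (t - y)⁺ + (y - t): calls are determined by puts, mass and
barycenter. -/
theorem integral_call {μ : Measure ℝ} (hμ : FiniteFirstMoment μ) (t : ℝ) :
    ∫ y, max (y - t) 0 ∂μ = put μ t - (μ.real univ * t - ∫ y, y ∂μ) := by
  have := hμ.1
  have h : (fun y => max (y - t) 0) = fun y => max (t - y) 0 + (y - t) := by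
    funext y
    rcases le_total y t with h | h
    · rw [max_eq_right (by linarith), max_eq_left (by linarith)]; ring
    · rw [max_eq_left (by linarith), max_eq_right (by linarith)]; ring
  have hsub : Integrable (fun y : ℝ => y - t) μ := hμ.2.sub (integrable_const t)
  rw [h, integral_add (hμ.integrable_put t) hsub,
    integral_sub hμ.2 (integrable_const t), integral_const, smul_eq_mul, put]
  ring

theorem put_nonneg (μ : Measure ℝ) (t : ℝ) : 0 ≤ put μ t :=
  integral_nonneg fun _ => le_max_right _ _

theorem le_put {μ : Measure ℝ} (hμ : FiniteFirstMoment μ) (t : ℝ) :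
    μ.real univ * t - ∫ y, y ∂μ ≤ put μ t := by
  have h := integral_call hμ t
  have h' : 0 ≤ ∫ y, max (y - t) 0 ∂μ := integral_nonneg fun _ => le_max_right _ _
  linarith

theorem put_add {μ ν : Measure ℝ} (hμ : FiniteFirstMoment μ) (hν : FiniteFirstMoment ν) :
    put (μ + ν) = put μ + put ν :=
  funext fun t => integral_add_measure (hμ.integrable_put t) (hν.integrable_put t)

theorem put_smul (μ : Measure ℝ) {a : ℝ} (ha : 0 ≤ a) (t : ℝ) :
    put (ENNReal.ofReal a • μ) t = a * put μ t := by
  rw [put, integral_smul_measure, ENNReal.toReal_ofReal ha, smul_eq_mul, put]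

theorem put_sub_le (x y t : ℝ) : max (x - y) 0 ≤ max (t - y) 0 + max (x - t) 0 := by
  refine max_le ?_ (by positivity)
  linarith [le_max_left (t - y) 0, le_max_left (x - t) 0]

theorem put_le_add {μ : Measure ℝ} (hμ : FiniteFirstMoment μ) (x t : ℝ) :
    put μ x ≤ put μ t + μ.real univ * max (x - t) 0 := by
  have := hμ.1
  have h : put μ x ≤ ∫ y, (max (t - y) 0 + max (x - t) 0) ∂μ :=
    integral_mono (hμ.integrable_put x) ((hμ.integrable_put t).add (integrable_const _))
      fun y => put_sub_le x y t
  rwa [integral_add (hμ.integrable_put t) (integrable_const _), integral_const, smul_eq_mul] at h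

/-- The distribution function of a finite measure. -/
noncomputable def distribution (μ : Measure ℝ) [IsFiniteMeasure μ] : StieltjesFunction ℝ where
  toFun t := μ.real (Iic t)
  mono' _ _ h := measureReal_mono (Iic_subset_Iic.2 h)
  right_continuous' t := by
    rw [← continuousWithinAt_Ioi_iff_Ici]
    have h := tendsto_measure_biInter_gt (μ := μ) (s := fun r : ℝ => Iic r) (a := t)
      (fun r _ => measurableSet_Iic.nullMeasurableSet) (fun i j _ hij => Iic_subset_Iic.2 hij)
      ⟨t + 1, by simp, measure_ne_top _ _⟩
    have hI : (⋂ r > t, Iic r) = Iic t := by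
      ext x
      simp only [gt_iff_lt, mem_iInter, mem_Iic]
      exact ⟨fun h => le_of_forall_gt_imp_ge_of_dense h, fun h r hr => h.trans hr.le⟩
    rw [hI] at h
    exact (ENNReal.tendsto_toReal (measure_ne_top _ _)).comp h

theorem measure_distribution (μ : Measure ℝ) [IsFiniteMeasure μ] :
    (distribution μ).measure = μ := by
  refine Measure.ext_of_Ioc _ _ fun a b hab => ?_
  rw [StieltjesFunction.measure_Ioc]
  change ENNReal.ofReal (μ.real (Iic b) - μ.real (Iic a)) = _
  rw [← measureReal_sdiff (Iic_subset_Iic.2 hab.le) measurableSet_Iic, Iic_sdiff_Iic,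
    ofReal_measureReal]

/-- For x < z, (z - y)⁺ - (x - y)⁺ lies between z - x times the indicators of y ≤ x and of y ≤ z. -/
theorem isSlope_put {μ : Measure ℝ} [IsFiniteMeasure μ] (hμ : FiniteFirstMoment μ) :
    IsSlope (distribution μ) (put μ) := by
  have key : ∀ w x z : ℝ, ∫ y, (Iic w).indicator (fun _ => z - x) y ∂μ
      = distribution μ w * (z - x) := by
    intro w x z
    rw [integral_indicator_const _ measurableSet_Iic, smul_eq_mul]
    rfl
  intro x z hxz
  have hsub : put μ z - put μ x = ∫ y, (max (z - y) 0 - max (x - y) 0) ∂μ :=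
    (integral_sub (hμ.integrable_put z) (hμ.integrable_put x)).symm
  have hint : ∀ w, Integrable ((Iic w).indicator (fun _ : ℝ => z - x)) μ := fun w =>
    (integrable_const _).indicator measurableSet_Iic
  rw [hsub, ← key x x z, ← key z x z]
  constructor
  · refine integral_mono (hint x) ((hμ.integrable_put z).sub (hμ.integrable_put x)) fun y => ?_
    simp only [indicator, mem_Iic]
    split_ifs with h
    · rw [max_eq_left (by linarith), max_eq_left (by linarith)]; linarith
    · rw [max_eq_right (a := x - y) (by linarith)]
      simp
  · refine integral_mono ((hμ.integrable_put z).sub (hμ.integrable_put x)) (hint z) fun y => ?_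
    simp only [indicator, mem_Iic]
    split_ifs with h
    · rw [max_eq_left (a := z - y) (by linarith)]
      linarith [le_max_left (x - y) 0]
    · rw [max_eq_right (by linarith), max_eq_right (by linarith)]
      simp

theorem convexOn_put {μ : Measure ℝ} (hμ : FiniteFirstMoment μ) : ConvexOn ℝ univ (put μ) := by
  have := hμ.1
  apply convexOn_of_le_affine
  intro p q x s c hp hq h1 h2
  have e1 := ((isSlope_put hμ) p x hp).2
  have e2 := ((isSlope_put hμ) x q hq).1
  nlinarith [mul_le_mul_of_nonneg_right e1 (sub_pos.2 hq).le,
    mul_le_mul_of_nonneg_right e2 (sub_pos.2 hp).le]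

/-- The missing part γ is the curvature measure of the difference: slopes add, and the
right-continuous slope of `put α` is unique. -/
theorem exists_add_of_convexOn_sub {α β : Measure ℝ} (hα : FiniteFirstMoment α)
    (hβ : FiniteFirstMoment β) (h : ConvexOn ℝ univ (put α - put β)) :
    ∃ γ, α = β + γ := by
  have := hα.1
  have := hβ.1
  obtain ⟨F, hF⟩ := exists_isSlope h
  have h1 : IsSlope (distribution β + F : StieltjesFunction ℝ) (put α) := by
    have := (isSlope_put hβ).add hF
    rwa [add_sub_cancel] at this
  refine ⟨F.measure, ?_⟩
  rw [← measure_distribution α, (isSlope_put hα).unique h1, StieltjesFunction.measure_add,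
    measure_distribution]

theorem tendsto_put_atBot {μ : Measure ℝ} (hμ : FiniteFirstMoment μ) :
    Tendsto (put μ) atBot (𝓝 0) := by
  have h : Tendsto (fun t => ∫ y, max (t - y) 0 ∂μ) atBot (𝓝 (∫ _, (0 : ℝ) ∂μ)) := by
    refine tendsto_integral_filter_of_dominated_convergence (fun y => |y|)
      (Eventually.of_forall fun t => (hμ.integrable_put t).aestronglyMeasurable) ?_ hμ.2.abs ?_
    · filter_upwards [eventually_le_atBot 0] with t ht
      refine Eventually.of_forall fun y => ?_
      rw [Real.norm_eq_abs, abs_of_nonneg (le_max_right _ _)]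
      exact max_le (by linarith [neg_abs_le y]) (abs_nonneg y)
    · refine Eventually.of_forall fun y => tendsto_const_nhds.congr' ?_
      filter_upwards [eventually_le_atBot y] with t ht
      rw [max_eq_right (by linarith)]
  rw [integral_zero] at h
  exact h

theorem tendsto_put_atTop {μ : Measure ℝ} (hμ : FiniteFirstMoment μ) :
    Tendsto (fun t => put μ t - (μ.real univ * t - ∫ y, y ∂μ)) atTop (𝓝 0) := by
  have h : Tendsto (fun t => ∫ y, max (y - t) 0 ∂μ) atTop (𝓝 (∫ _, (0 : ℝ) ∂μ)) := by
    refine tendsto_integral_filter_of_dominated_convergence (fun y => |y|)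
      (Eventually.of_forall fun t => (hμ.integrable_call t).aestronglyMeasurable) ?_ hμ.2.abs ?_
    · filter_upwards [eventually_ge_atTop 0] with t ht
      refine Eventually.of_forall fun y => ?_
      rw [Real.norm_eq_abs, abs_of_nonneg (le_max_right _ _)]
      exact max_le (by linarith [le_abs_self y]) (abs_nonneg y)
    · refine Eventually.of_forall fun y => tendsto_const_nhds.congr' ?_
      filter_upwards [eventually_ge_atTop y] with t ht
      rw [max_eq_right (by linarith)]
  simpa [integral_call hμ] using h

/-- The increment over a unit shift is constantly `s` and tends to 0. -/
theorem eq_zero_of_tendsto_affine {l : Filter ℝ} [l.NeBot] (hl : Tendsto (fun x => x + 1) l l)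
    {s c : ℝ} (h : Tendsto (fun x => s * x + c) l (𝓝 0)) : s = 0 ∧ c = 0 := by
  have h1 : Tendsto (fun x => s * (x + 1) + c - (s * x + c)) l (𝓝 (0 - 0)) := (h.comp hl).sub h
  have h2 : (fun x => s * (x + 1) + c - (s * x + c)) = fun _ : ℝ => s := by
    funext x
    ring
  rw [h2, sub_zero] at h1
  obtain rfl : s = 0 := tendsto_nhds_unique tendsto_const_nhds h1
  simp only [zero_mul, zero_add] at h
  exact ⟨rfl, tendsto_nhds_unique tendsto_const_nhds h⟩

/-- A convex function with the asymptotics of a potential function whose difference to the potential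
function of `ν` is convex is the potential function of a measure `η ≤ ν`. -/
theorem exists_measure_put_eq {ν : Measure ℝ} (hν : FiniteFirstMoment ν) {k : ℝ → ℝ}
    (hk : ConvexOn ℝ univ k) (hc : ConvexOn ℝ univ (put ν - k)) (hbot : Tendsto k atBot (𝓝 0))
    {M m : ℝ} (htop : Tendsto (fun t => k t - (M * t - m)) atTop (𝓝 0)) :
    ∃ η ≤ ν, FiniteFirstMoment η ∧ put η = k ∧ η.real univ = M ∧ ∫ y, y ∂η = m := by
  have := hν.1
  obtain ⟨F, hF⟩ := exists_isSlope hk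
  obtain ⟨G, hG⟩ := exists_isSlope hc
  have h1 : IsSlope (F + G : StieltjesFunction ℝ) (put ν) := by
    have := hF.add hG
    rwa [add_sub_cancel] at this
  have hsum : ν = F.measure + G.measure := by
    rw [← StieltjesFunction.measure_add, ← (isSlope_put hν).unique h1, measure_distribution]
  have hle : F.measure ≤ ν := by
    conv_rhs => rw [hsum]
    exact Measure.le_add_right le_rfl
  have hη := hν.mono hle
  have := hη.1
  -- The curvature measure fixes `k` only up to an affine function. The limit at -∞ shows that this
  -- function vanishes; the asymptotics at +∞ then give mass and barycenter.
  obtain ⟨s, c, hsc⟩ := exists_affine_of_measure_eq hk (convexOn_put hη) hF (isSlope_put hη)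
    (measure_distribution _).symm
  have h0 : s = 0 ∧ c = 0 := by
    refine eq_zero_of_tendsto_affine (l := atBot) (tendsto_atBot_add_const_right _ _ tendsto_id) ?_
    have := hbot.sub (tendsto_put_atBot hη)
    rw [sub_zero] at this
    exact this.congr fun x => by rw [hsc]; ring
  obtain ⟨rfl, rfl⟩ := h0
  have hput : put F.measure = k := funext fun x => by rw [hsc]; ring
  have h2 : (F.measure.real univ - M) = 0 ∧ (m - ∫ y, y ∂F.measure) = 0 := by
    refine eq_zero_of_tendsto_affine (l := atTop) (tendsto_atTop_add_const_right _ _ tendsto_id) ?_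
    have := htop.sub (tendsto_put_atTop hη)
    rw [sub_zero, hput] at this
    exact this.congr fun x => by ring
  exact ⟨F.measure, hle, hη, hput, by linarith [h2.1], by linarith [h2.2]⟩

/-! ### Convex order through potential functions -/

/-- The nonnegative kernel in Taylor's formula at `0`. -/
noncomputable def taylorKernel (x t : ℝ) : ENNReal :=
  if 0 < t then ENNReal.ofReal (x - t) else ENNReal.ofReal (t - x)

theorem measurable_taylorKernel : Measurable (Function.uncurry taylorKernel) := by
  refine Measurable.ite (measurableSet_lt measurable_const measurable_snd) ?_ ?_ <;> fun_prop

/-- Tonelli for the region `S`: its sections at fixed s have ρ-mass `f s`, those at fixed t are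
measured by length. -/
theorem ofReal_integral_Ioc {f : ℝ → ℝ} (ρ : Measure ℝ) [SFinite ρ] {a b : ℝ} (hab : a ≤ b)
    {S : Set (ℝ × ℝ)} (hS : MeasurableSet S) (hf : IntervalIntegrable f volume a b)
    (hfS : ∀ s ∈ Ioc a b, 0 ≤ f s ∧ ENNReal.ofReal (f s) = ρ {t | (s, t) ∈ S}) :
    ENNReal.ofReal (∫ s in a..b, f s) = ∫⁻ t, volume (Ioc a b ∩ {s | (s, t) ∈ S}) ∂ρ := by
  rw [intervalIntegral.integral_of_le hab, ofReal_integral_eq_lintegral_ofReal hf.1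
    ((ae_restrict_iff' measurableSet_Ioc).2 (Eventually.of_forall fun s hs => (hfS s hs).1)),
    setLIntegral_congr_fun measurableSet_Ioc (fun s hs => (hfS s hs).2)]
  have h1 := Measure.prod_apply (μ := volume.restrict (Ioc a b)) (ν := ρ) hS
  have h2 := Measure.prod_apply_symm (μ := volume.restrict (Ioc a b)) (ν := ρ) hS
  rw [h1] at h2
  refine h2.trans (lintegral_congr fun t => ?_)
  rw [Measure.restrict_apply' measurableSet_Ioc, inter_comm]
  rfl

/-- Integrate the slope increment from 0, which is the mass of (0, s] for s > 0 and minus the mass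
of (s, 0] for s < 0, and exchange the integrals. -/
theorem ofReal_sub_affine_eq_lintegral {φ : ℝ → ℝ} (hφ : ConvexOn ℝ univ φ)
    {F : StieltjesFunction ℝ} (hF : IsSlope F φ) (x : ℝ) :
    0 ≤ φ x - (φ 0 + F 0 * x) ∧
      ENNReal.ofReal (φ x - (φ 0 + F 0 * x)) = ∫⁻ t, taylorKernel x t ∂F.measure := by
  rcases le_total 0 x with hx | hx
  · have hint : IntervalIntegrable (fun s => F s - F 0) volume 0 x :=
      F.mono.intervalIntegrable.sub (by simp)
    have h1 : φ x - (φ 0 + F 0 * x) = ∫ s in (0)..x, (F s - F 0) := by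
      rw [intervalIntegral.integral_sub F.mono.intervalIntegrable (by simp),
        hF.integral_eq hφ hx, intervalIntegral.integral_const, smul_eq_mul]
      ring
    refine ⟨?_, ?_⟩
    · rw [h1]
      exact intervalIntegral.integral_nonneg hx fun s hs => sub_nonneg.2 (F.mono hs.1)
    · rw [h1, ofReal_integral_Ioc F.measure hx (S := {p | 0 < p.2 ∧ p.2 ≤ p.1})
        ((measurableSet_lt measurable_const measurable_snd).inter
          (measurableSet_le measurable_snd measurable_fst)) hint]
      · refine lintegral_congr fun t => ?_
        rw [taylorKernel]
        split_ifs with ht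
        · have : Ioc 0 x ∩ {s | (s, t) ∈ {p : ℝ × ℝ | 0 < p.2 ∧ p.2 ≤ p.1}} = Icc t x := by
            ext s
            simp only [mem_inter_iff, mem_Ioc, mem_ofPred_eq, mem_Icc]
            exact ⟨fun h => ⟨h.2.2, h.1.2⟩, fun h => ⟨⟨ht.trans_le h.1, h.2⟩, ht, h.1⟩⟩
          rw [this, Real.volume_Icc]
        · have : Ioc 0 x ∩ {s | (s, t) ∈ {p : ℝ × ℝ | 0 < p.2 ∧ p.2 ≤ p.1}} = ∅ := by
            ext s
            simp only [mem_inter_iff, mem_ofPred_eq, mem_empty_iff_false, iff_false]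
            exact fun h => ht h.2.1
          rw [this, measure_empty, ENNReal.ofReal_of_nonpos (by linarith)]
      · intro s hs
        refine ⟨sub_nonneg.2 (F.mono hs.1.le), ?_⟩
        rw [← StieltjesFunction.measure_Ioc]
        rfl
  · have hint : IntervalIntegrable (fun s => F 0 - F s) volume x 0 :=
      IntervalIntegrable.sub (by simp) F.mono.intervalIntegrable
    have h1 : φ x - (φ 0 + F 0 * x) = ∫ s in x..0, (F 0 - F s) := by
      rw [intervalIntegral.integral_sub (by simp) F.mono.intervalIntegrable,
        hF.integral_eq hφ hx, intervalIntegral.integral_const, smul_eq_mul]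
      ring
    refine ⟨?_, ?_⟩
    · rw [h1]
      exact intervalIntegral.integral_nonneg hx fun s hs => sub_nonneg.2 (F.mono hs.2)
    · rw [h1, ofReal_integral_Ioc F.measure hx (S := {p | p.1 < p.2 ∧ p.2 ≤ 0})
        ((measurableSet_lt measurable_fst measurable_snd).inter
          (measurableSet_le measurable_snd measurable_const)) hint]
      · refine lintegral_congr fun t => ?_
        rw [taylorKernel]
        split_ifs with ht
        · have : Ioc x 0 ∩ {s | (s, t) ∈ {p : ℝ × ℝ | p.1 < p.2 ∧ p.2 ≤ 0}} = ∅ := by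
            ext s
            simp only [mem_inter_iff, mem_ofPred_eq, mem_empty_iff_false, iff_false]
            exact fun h => absurd h.2.2 (not_le.2 ht)
          rw [this, measure_empty, ENNReal.ofReal_of_nonpos (by linarith)]
        · have : Ioc x 0 ∩ {s | (s, t) ∈ {p : ℝ × ℝ | p.1 < p.2 ∧ p.2 ≤ 0}} = Ioo x t := by
            ext s
            simp only [mem_inter_iff, mem_Ioc, mem_ofPred_eq, mem_Ioo]
            exact ⟨fun h => ⟨h.1.1, h.2.1⟩,
              fun h => ⟨⟨h.1, h.2.le.trans (not_lt.1 ht)⟩, h.2, not_lt.1 ht⟩⟩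
          rw [this, Real.volume_Ioo]
      · intro s hs
        refine ⟨sub_nonneg.2 (F.mono hs.2), ?_⟩
        rw [← StieltjesFunction.measure_Ioc]
        rfl

theorem ofReal_max_zero (a : ℝ) : ENNReal.ofReal (max a 0) = ENNReal.ofReal a := by
  rcases le_total a 0 with h | h
  · rw [max_eq_right h, ENNReal.ofReal_zero, ENNReal.ofReal_of_nonpos h]
  · rw [max_eq_left h]

theorem lintegral_ofReal_sub_right {μ : Measure ℝ} (hμ : FiniteFirstMoment μ) (t : ℝ) :
    ∫⁻ y, ENNReal.ofReal (t - y) ∂μ = ENNReal.ofReal (put μ t) := by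
  rw [put, ofReal_integral_eq_lintegral_ofReal (hμ.integrable_put t)
    (Eventually.of_forall fun _ => le_max_right _ _)]
  simp only [ofReal_max_zero]

theorem lintegral_ofReal_sub_left {μ : Measure ℝ} (hμ : FiniteFirstMoment μ) (t : ℝ) :
    ∫⁻ y, ENNReal.ofReal (y - t) ∂μ
      = ENNReal.ofReal (put μ t - (μ.real univ * t - ∫ y, y ∂μ)) := by
  rw [← integral_call hμ, ofReal_integral_eq_lintegral_ofReal (hμ.integrable_call t)
    (Eventually.of_forall fun _ => le_max_right _ _)]
  simp only [ofReal_max_zero]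

theorem ConvexLE.measureReal_univ {μ ν : Measure ℝ} (h : ConvexLE μ ν) :
    μ.real univ = ν.real univ := by
  obtain ⟨hμ, hν, h⟩ := h
  have := hμ.1
  have := hν.1
  have h1 := h (fun _ => 1) (convexOn_const _ convex_univ) (integrable_const _) (integrable_const _)
  have h2 := h (fun _ => -1) (convexOn_const _ convex_univ) (integrable_const _)
    (integrable_const _)
  simp at h1 h2
  exact le_antisymm h1 h2

theorem ConvexLE.integral_id {μ ν : Measure ℝ} (h : ConvexLE μ ν) :
    ∫ y, y ∂μ = ∫ y, y ∂ν := by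
  obtain ⟨hμ, hν, h⟩ := h
  have c1 : ConvexOn ℝ univ (fun x : ℝ => x) := convexOn_id convex_univ
  have c2 : ConvexOn ℝ univ (fun x : ℝ => -x) := (concaveOn_id convex_univ).neg
  have h1 := h _ c1 hμ.2 hν.2
  have h2 := h _ c2 hμ.2.neg hν.2.neg
  rw [integral_neg, integral_neg] at h2
  linarith

theorem convexOn_max_sub (t : ℝ) : ConvexOn ℝ univ (fun y : ℝ => max (t - y) 0) := by
  have h := (convexOn_affine (-1) t).sup (convexOn_const (0 : ℝ) convex_univ)
  refine h.congr fun y _ => ?_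
  simp only [Pi.sup_apply]
  congr 1
  ring

theorem ConvexLE.put_le {μ ν : Measure ℝ} (h : ConvexLE μ ν) : put μ ≤ put ν := fun t =>
  h.2.2 _ (convexOn_max_sub t) (h.1.integrable_put t) (h.2.1.integrable_put t)

/-- Measures with equal mass and barycenter are ordered if their potential functions are. -/
theorem convexLE_of_put_le {μ ν : Measure ℝ} (hμ : FiniteFirstMoment μ) (hν : FiniteFirstMoment ν)
    (hmass : μ.real univ = ν.real univ) (hmean : ∫ y, y ∂μ = ∫ y, y ∂ν) (hput : put μ ≤ put ν) :
    ConvexLE μ ν := by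
  have := hμ.1
  have := hν.1
  refine ⟨hμ, hν, fun φ hφ hφμ hφν => ?_⟩
  obtain ⟨F, hF⟩ := exists_isSlope hφ
  -- Minus its supporting line at 0, `φ` is a mixture of calls struck at t > 0 and puts struck at t
  -- ≤ 0. Parity reduces calls to puts; the affine part has equal integrals by mass and barycenter.
  have htay := ofReal_sub_affine_eq_lintegral hφ hF
  have hswap : ∀ θ : Measure ℝ, IsFiniteMeasure θ →
      ∫⁻ x, ENNReal.ofReal (φ x - (φ 0 + F 0 * x)) ∂θ
        = ∫⁻ t, ∫⁻ x, taylorKernel x t ∂θ ∂F.measure := by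
    intro θ _
    rw [lintegral_congr fun x => (htay x).2]
    exact lintegral_lintegral_swap measurable_taylorKernel.aemeasurable
  have haff : ∀ θ : Measure ℝ, FiniteFirstMoment θ →
      Integrable (fun x => φ 0 + F 0 * x) θ := by
    intro θ hθ
    have := hθ.1
    exact (integrable_const _).add (hθ.2.const_mul _)
  have haffint : ∀ θ : Measure ℝ, FiniteFirstMoment θ →
      ∫ x, (φ 0 + F 0 * x) ∂θ = θ.real univ * φ 0 + F 0 * ∫ x, x ∂θ := by
    intro θ hθ
    have := hθ.1
    rw [integral_add (integrable_const _) (hθ.2.const_mul _), integral_const, integral_const_mul,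
      smul_eq_mul]
  have hiμ : Integrable (fun x => φ x - (φ 0 + F 0 * x)) μ := hφμ.sub (haff μ hμ)
  have hiν : Integrable (fun x => φ x - (φ 0 + F 0 * x)) ν := hφν.sub (haff ν hν)
  have hle : ∫⁻ x, ENNReal.ofReal (φ x - (φ 0 + F 0 * x)) ∂μ
      ≤ ∫⁻ x, ENNReal.ofReal (φ x - (φ 0 + F 0 * x)) ∂ν := by
    rw [hswap μ hμ.1, hswap ν hν.1]
    refine lintegral_mono fun t => ?_
    simp only [taylorKernel]
    split_ifs
    · rw [lintegral_ofReal_sub_left hμ, lintegral_ofReal_sub_left hν, hmass, hmean]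
      exact ENNReal.ofReal_le_ofReal (by linarith [hput t])
    · rw [lintegral_ofReal_sub_right hμ, lintegral_ofReal_sub_right hν]
      exact ENNReal.ofReal_le_ofReal (hput t)
  rw [← ofReal_integral_eq_lintegral_ofReal hiμ (Eventually.of_forall fun x => (htay x).1),
    ← ofReal_integral_eq_lintegral_ofReal hiν (Eventually.of_forall fun x => (htay x).1),
    ENNReal.ofReal_le_ofReal_iff (integral_nonneg fun x => (htay x).1),
    integral_sub hφμ (haff μ hμ), integral_sub hφν (haff ν hν), haffint μ hμ, haffint ν hν,
    hmass, hmean] at hle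
  linarith

/-! ### Shadows: existence, potential function, additivity, local estimate -/

theorem FiniteFirstMoment.sub_add_cancel {η ν : Measure ℝ} (hν : FiniteFirstMoment ν) (h : η ≤ ν) :
    η + (ν - η) = ν := by
  have := hν.1
  have := (hν.mono h).1
  rw [add_comm, Measure.sub_add_cancel_of_le h]

theorem FiniteFirstMoment.sub {η ν : Measure ℝ} (hν : FiniteFirstMoment ν) :
    FiniteFirstMoment (ν - η) := hν.mono Measure.sub_le

theorem put_sub {η ν : Measure ℝ} (hν : FiniteFirstMoment ν) (h : η ≤ ν) :
    put (ν - η) = put ν - put η := by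
  have h1 := put_add (hν.mono h) (hν.sub (η := η))
  rw [hν.sub_add_cancel h] at h1
  rw [h1, add_sub_cancel_left]

theorem measureReal_univ_add {μ ν : Measure ℝ} (hμ : FiniteFirstMoment μ)
    (hν : FiniteFirstMoment ν) : (μ + ν).real univ = μ.real univ + ν.real univ := by
  have := hμ.1
  have := hν.1
  exact measureReal_add_apply

theorem integral_id_add {μ ν : Measure ℝ} (hμ : FiniteFirstMoment μ) (hν : FiniteFirstMoment ν) :
    ∫ y, y ∂(μ + ν) = ∫ y, y ∂μ + ∫ y, y ∂ν := integral_add_measure hμ.2 hν.2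

theorem put_le_sub_put {μ ν ρ : Measure ℝ} (hμ : FiniteFirstMoment μ) (hρ : FiniteFirstMoment ρ)
    (h : ConvexLE (μ + ρ) ν) : put ρ ≤ put ν - put μ := by
  intro t
  have := h.put_le t
  rw [put_add hμ hρ] at this
  simp only [Pi.add_apply, Pi.sub_apply] at this ⊢
  linarith

/-- If `μ` is part of a measure below `ν` in convex order, then `μ` has a shadow in `ν`, and its
potential function is given by a convex envelope. -/
theorem exists_isShadow {μ ν ρ : Measure ℝ} (hμ : FiniteFirstMoment μ) (hρ : FiniteFirstMoment ρ)
    (h : ConvexLE (μ + ρ) ν) :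
    ∃ η, IsShadow ν μ η ∧ put η = put ν - envelope (put ν - put μ) := by
  have hν := h.2.1
  have hρV := put_le_sub_put hμ hρ h
  have hcρ := convexOn_put hρ
  have hE := convexOn_envelope hcρ hρV
  have hk := convexOn_sub_envelope (convexOn_put hν) (convexOn_put hμ) hcρ hρV
  -- The candidate potential is squeezed between `put μ` and `put ν - put ρ`, which share the
  -- asymptotics given by the mass and barycenter of `μ`.
  have hlow : put μ ≤ put ν - envelope (put ν - put μ) := fun t => by
    have := envelope_le hcρ hρV t
    simp only [Pi.sub_apply] at this ⊢
    linarith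
  have hup : put ν - envelope (put ν - put μ) ≤ put ν - put ρ :=
    sub_le_sub_left (le_envelope hcρ hρV) _
  have hmass := h.measureReal_univ
  have hmean := h.integral_id
  rw [measureReal_univ_add hμ hρ] at hmass
  rw [integral_id_add hμ hρ] at hmean
  obtain ⟨η, hην, hη, hput, hηmass, hηmean⟩ := exists_measure_put_eq hν hk
    (by rwa [sub_sub_cancel])
    (by
      have hb := (tendsto_put_atBot hν).sub (tendsto_put_atBot hρ)
      rw [sub_zero] at hb
      exact tendsto_of_tendsto_of_tendsto_of_le_of_le (tendsto_put_atBot hμ) hb hlow hup)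
    (M := μ.real univ) (m := ∫ y, y ∂μ)
    (by
      have hb := (tendsto_put_atTop hν).sub (tendsto_put_atTop hρ)
      rw [sub_zero] at hb
      refine tendsto_of_tendsto_of_tendsto_of_le_of_le (tendsto_put_atTop hμ) hb
        (fun t => sub_le_sub_right (hlow t) _) (fun t => ?_)
      have := hup t
      simp only [Pi.sub_apply] at this ⊢
      rw [← hmass, ← hmean]
      linarith)
  refine ⟨η, ⟨?_, hην, ?_⟩, hput⟩
  · exact convexLE_of_put_le hμ hη hηmass.symm hηmean.symm (hput ▸ hlow)
  · intro η' h1 h2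
    refine convexLE_of_put_le hη h1.2.1 (hηmass.trans h1.measureReal_univ)
      (hηmean.trans h1.integral_id) ?_
    rw [hput]
    -- A competitor yields the convex minorant `put (ν - η')`, which the envelope dominates.
    have h3 : put (ν - η') ≤ put ν - put μ := by
      rw [put_sub hν h2]
      exact sub_le_sub_left h1.put_le _
    have h4 := le_envelope (convexOn_put hν.sub) h3
    rw [put_sub hν h2] at h4
    exact sub_le_comm.1 h4

/-- The chosen shadow and the constructed one are each minimal, so their potentials agree. -/
theorem isShadow_shadow {μ ν ρ : Measure ℝ} (hμ : FiniteFirstMoment μ) (hρ : FiniteFirstMoment ρ)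
    (h : ConvexLE (μ + ρ) ν) :
    IsShadow ν μ (shadow ν μ) ∧ put (shadow ν μ) = put ν - envelope (put ν - put μ) := by
  obtain ⟨η, hη, hput⟩ := exists_isShadow hμ hρ h
  have hs : IsShadow ν μ (shadow ν μ) := by
    have hex : ∃ η, IsShadow ν μ η := ⟨η, hη⟩
    rw [shadow, dif_pos hex]
    exact hex.choose_spec
  exact ⟨hs, hput ▸ le_antisymm (hs.minimal η hη.convexLE hη.le).put_le
    (hη.minimal _ hs.convexLE hs.le).put_le⟩

/-- Additivity of the shadow: the increment of the shadow is the shadow of the increment in the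
remaining part of `ν`. -/
theorem exists_shadow_add {μ σ ν ρ : Measure ℝ} (hμ : FiniteFirstMoment μ)
    (hσ : FiniteFirstMoment σ) (hρ : FiniteFirstMoment ρ) (h : ConvexLE (μ + σ + ρ) ν) :
    ∃ η, shadow ν (μ + σ) = shadow ν μ + η ∧ η ≤ ν - shadow ν μ ∧ ConvexLE σ η ∧
      put η = put (ν - shadow ν μ) - envelope (put (ν - shadow ν μ) - put σ) := by
  have hν := h.2.1
  have h' : ConvexLE (μ + (σ + ρ)) ν := by rwa [← add_assoc]
  obtain ⟨s1, p1⟩ := isShadow_shadow hμ (hσ.add hρ) h'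
  obtain ⟨s2, p2⟩ := isShadow_shadow (hμ.add hσ) hρ h
  set η₁ := shadow ν μ
  set η₂ := shadow ν (μ + σ)
  have hη₁ := s1.convexLE.2.1
  have hη₂ := s2.convexLE.2.1
  have hν' : FiniteFirstMoment (ν - η₁) := hν.sub
  have hW : put (ν - η₁) = envelope (put ν - put μ) := by
    rw [put_sub hν s1.le, p1, sub_sub_cancel]
  have hcρ := convexOn_put hρ
  have hρV : put ρ ≤ put ν - put μ - put σ := by
    have := put_le_sub_put (hμ.add hσ) hρ h
    rwa [put_add hμ hσ, ← sub_sub] at this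
  have hEE : envelope (put (ν - η₁) - put σ) = envelope (put ν - put μ - put σ) := by
    rw [hW]
    exact envelope_envelope_sub (convexOn_put hσ) hcρ hρV
  have hdiff : put η₂ - put η₁ = put (ν - η₁) - envelope (put (ν - η₁) - put σ) := by
    rw [hEE, p2, put_sub hν s1.le, put_add hμ hσ, ← sub_sub]
    abel
  have hρV' : put ρ ≤ put (ν - η₁) - put σ := by
    have h1 : put (σ + ρ) ≤ put (ν - η₁) := by
      rw [hW]
      exact le_envelope (convexOn_put (hσ.add hρ)) (put_le_sub_put hμ (hσ.add hρ) h')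
    rw [put_add hσ hρ] at h1
    exact le_sub_iff_add_le'.2 h1
  have hconv := convexOn_sub_envelope (convexOn_put hν') (convexOn_put hσ) hcρ hρV'
  -- The difference of the two shadow potentials has the form g - env(g - f), hence is convex, so
  -- the increment is a positive measure.
  obtain ⟨η, hη⟩ := exists_add_of_convexOn_sub hη₂ hη₁ (by rwa [hdiff])
  have hηF : FiniteFirstMoment η := hη₂.mono (by rw [hη]; exact Measure.le_add_left le_rfl)
  have hput : put η = put (ν - η₁) - envelope (put (ν - η₁) - put σ) := by
    rw [← hdiff, hη, put_add hη₁ hηF, add_sub_cancel_left]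
  have hσle : put σ ≤ put (ν - η₁) - envelope (put (ν - η₁) - put σ) :=
    le_sub_comm.1 (envelope_le hcρ hρV')
  refine ⟨η, hη, ?_, ?_, hput⟩
  · obtain ⟨γ, hγ⟩ := exists_add_of_convexOn_sub hν' hηF
      (by rw [hput, sub_sub_cancel]; exact convexOn_envelope hcρ hρV')
    rw [hγ]
    exact Measure.le_add_right le_rfl
  · have m1 := s1.convexLE.measureReal_univ
    have m2 := s2.convexLE.measureReal_univ
    have e1 := s1.convexLE.integral_id
    have e2 := s2.convexLE.integral_id
    rw [measureReal_univ_add hμ hσ] at m2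
    rw [integral_id_add hμ hσ] at e2
    change _ = η₂.real univ at m2
    change _ = ∫ y, y ∂η₂ at e2
    rw [hη, measureReal_univ_add hη₁ hηF] at m2
    rw [hη, integral_id_add hη₁ hηF] at e2
    exact convexLE_of_put_le hσ hηF (by linarith) (by linarith) (hput ▸ hσle)

/-- At a point near which `ν` carries at least the mass of `σ`, the shadow of `σ` in `ν` has almost
the same potential as `σ`. -/
theorem sub_envelope_le {σ ν : Measure ℝ} (hσ : FiniteFirstMoment σ) (hν : FiniteFirstMoment ν)
    {t δ : ℝ} (hδ : 0 ≤ δ) (h : σ.real univ ≤ ν.real (Icc (t - δ) (t + δ))) :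
    put ν t - envelope (put ν - put σ) t ≤ put σ t + 2 * σ.real univ * δ := by
  have := hν.1
  set B := Icc (t - δ) (t + δ)
  set r := σ.real univ
  -- `a` scales `ν` on `B` down to a part `β ≤ ν` with the mass of `σ`. If `B` is null, then `r = 0`
  -- and `a = 0` serves.
  obtain ⟨a, ha0, ha1, har⟩ : ∃ a, 0 ≤ a ∧ a ≤ 1 ∧ r = a * ν.real B := by
    rcases (measureReal_nonneg (μ := ν) (s := B)).eq_or_lt with h0 | h0
    · exact ⟨0, le_rfl, zero_le_one, by
        rw [zero_mul]; exact le_antisymm (h0 ▸ h) measureReal_nonneg⟩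
    · exact ⟨r / ν.real B, by positivity, (div_le_one h0).2 h, by field_simp⟩
  have hr : 0 ≤ r := measureReal_nonneg
  have hνB : FiniteFirstMoment (ν.restrict B) := hν.mono Measure.restrict_le_self
  set β := ENNReal.ofReal a • ν.restrict B
  have hβ : FiniteFirstMoment β := hνB.smul a
  have hβν : β ≤ ν := by
    intro A
    calc β A = ENNReal.ofReal a * ν.restrict B A := rfl
      _ ≤ 1 * ν.restrict B A := by
        gcongr
        exact ENNReal.ofReal_le_one.2 ha1
      _ ≤ ν A := by
        rw [one_mul]
        exact Measure.restrict_le_self A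
  have hconst : ∀ e : ℝ, ∫ _, e ∂(ν.restrict B) = ν.real B * e := fun e => by
    rw [setIntegral_const, smul_eq_mul]
  have hlow : ∀ x, r * max (x - t) 0 - r * δ ≤ put β x := by
    intro x
    rw [put_smul _ ha0, har]
    have : ν.real B * (max (x - t) 0 - δ) ≤ put (ν.restrict B) x := by
      rw [← hconst]
      refine setIntegral_mono_on (integrable_const _) (hνB.integrable_put x) measurableSet_Icc ?_
      intro y hy
      have h1 := le_max_left (x - y) 0
      have h2 := le_max_right (x - y) 0
      rw [sub_le_iff_le_add]
      exact max_le (by linarith [hy.2]) (by linarith)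
    nlinarith
  have hupp : put β t ≤ r * δ := by
    rw [put_smul _ ha0, har]
    have : put (ν.restrict B) t ≤ ν.real B * δ := by
      rw [← hconst]
      refine setIntegral_mono_on (hνB.integrable_put t) (integrable_const _) measurableSet_Icc ?_
      intro y hy
      exact max_le (by linarith [hy.1]) hδ
    nlinarith
  have hsub := put_sub hν hβν
  -- This is a minorant of `put ν - put σ`, since put σ x ≤ put σ t + r (x - t)⁺ ≤ put σ t + put β x
  -- + r δ. Evaluated at `t` it loses a further `put β t ≤ r * δ`, whence the factor 2.
  have hc : ConvexOn ℝ univ (fun x => put (ν - β) x + -(r * δ + put σ t)) :=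
    (convexOn_put hν.sub).add_const _
  have hcV : (fun x => put (ν - β) x + -(r * δ + put σ t)) ≤ put ν - put σ := by
    intro x
    have h1 := hlow x
    have h2 := put_le_add hσ x t
    simp only [hsub, Pi.sub_apply]
    linarith
  have := le_envelope hc hcV t
  simp only [hsub, Pi.sub_apply] at this
  linarith

/-! ### From convergence of potentials to convergence of integrals -/

/-- `f` is continuous of at most linear growth, and its integrals with respect to `η i` converge to
that with respect to `θ`. -/
def ConvergesOn {ι : Type*} (l : Filter ι) (η : ι → Measure ℝ) (θ : Measure ℝ) (f : ℝ → ℝ) : Prop :=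
  (Continuous f ∧ ∃ C : ℝ, ∀ x, |f x| ≤ C * (1 + |x|)) ∧
    Tendsto (fun i => ∫ x, f x ∂(η i)) l (𝓝 (∫ x, f x ∂θ))

section Convergence

variable {ι : Type*} {l : Filter ι} {η : ι → Measure ℝ} {θ : Measure ℝ}

theorem ConvergesOn.integrable {f : ℝ → ℝ} (hf : ConvergesOn l η θ f) {μ : Measure ℝ}
    (hμ : FiniteFirstMoment μ) : Integrable f μ := by
  obtain ⟨⟨hc, C, hC⟩, -⟩ := hf
  exact hμ.integrable hc hC

theorem ConvergesOn.add (hη : ∀ᶠ i in l, FiniteFirstMoment (η i)) (hθ : FiniteFirstMoment θ)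
    {f g : ℝ → ℝ} (hf : ConvergesOn l η θ f) (hg : ConvergesOn l η θ g) :
    ConvergesOn l η θ (fun x => f x + g x) := by
  have hf' := hf
  have hg' := hg
  obtain ⟨⟨hfc, C, hC⟩, h1⟩ := hf
  obtain ⟨⟨hgc, D, hD⟩, h2⟩ := hg
  refine ⟨⟨hfc.add hgc, C + D, fun x => ?_⟩, ?_⟩
  · rw [add_mul]
    exact (abs_add_le _ _).trans (add_le_add (hC x) (hD x))
  · rw [integral_add (hf'.integrable hθ) (hg'.integrable hθ)]
    refine (h1.add h2).congr' ?_
    filter_upwards [hη] with i hi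
    rw [integral_add (hf'.integrable hi) (hg'.integrable hi)]

theorem ConvergesOn.const_mul {f : ℝ → ℝ} (hf : ConvergesOn l η θ f) (a : ℝ) :
    ConvergesOn l η θ (fun x => a * f x) := by
  obtain ⟨⟨hfc, C, hC⟩, h1⟩ := hf
  refine ⟨⟨continuous_const.mul hfc, |a| * C, fun x => ?_⟩, ?_⟩
  · rw [abs_mul, mul_assoc]
    exact mul_le_mul_of_nonneg_left (hC x) (abs_nonneg a)
  · simp only [integral_const_mul]
    exact h1.const_mul a

theorem ConvergesOn.sum (hη : ∀ᶠ i in l, FiniteFirstMoment (η i)) (hθ : FiniteFirstMoment θ)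
    {f : ℕ → ℝ → ℝ} (hf : ∀ n, ConvergesOn l η θ (f n)) (N : ℕ) :
    ConvergesOn l η θ (fun x => ∑ n ∈ Finset.range N, f n x) := by
  induction N with
  | zero => exact ⟨⟨by simpa using continuous_const, 0, fun x => by simp⟩, by
      simpa using tendsto_const_nhds⟩
  | succ N ih =>
    simp only [Finset.sum_range_succ]
    exact ih.add hη hθ (hf N)

/-- The error bound `q` is itself a convergent test function, so its smallness under `θ` transfers
eventually to `η i`; this replaces a separate tightness argument. -/
theorem ConvergesOn.of_approx (hη : ∀ᶠ i in l, FiniteFirstMoment (η i)) (hθ : FiniteFirstMoment θ)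
    {f : ℝ → ℝ} (hfc : Continuous f) {C : ℝ} (hC : ∀ x, |f x| ≤ C * (1 + |x|))
    (h : ∀ ε > 0, ∃ g q : ℝ → ℝ, ConvergesOn l η θ g ∧ ConvergesOn l η θ q ∧
      (∀ x, |f x - g x| ≤ q x) ∧ ∫ x, q x ∂θ ≤ ε) : ConvergesOn l η θ f := by
  refine ⟨⟨hfc, C, hC⟩, ?_⟩
  have hdiff : ∀ μ : Measure ℝ, FiniteFirstMoment μ → ∀ g q : ℝ → ℝ, Integrable g μ →
      Integrable q μ → (∀ x, |f x - g x| ≤ q x) → |∫ x, f x ∂μ - ∫ x, g x ∂μ| ≤ ∫ x, q x ∂μ := by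
    intro μ hμ g q hg hq hfg
    rw [← integral_sub (hμ.integrable hfc hC) hg]
    exact norm_integral_le_of_norm_le (f := fun x => f x - g x) hq (Eventually.of_forall hfg)
  rw [Metric.tendsto_nhds]
  intro ε hε
  obtain ⟨g, q, hg, hq, hfg, hqε⟩ := h (ε / 4) (by positivity)
  have h1 := Metric.tendsto_nhds.1 hg.2 (ε / 4) (by positivity)
  have h2 := hq.2.eventually_lt_const (show ∫ x, q x ∂θ < ε / 2 by linarith)
  filter_upwards [hη, h1, h2] with i hi h1 h2
  have h3 := hdiff _ hi g q (hg.integrable hi) (hq.integrable hi) hfg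
  have h4 := hdiff _ hθ g q (hg.integrable hθ) (hq.integrable hθ) hfg
  rw [Real.dist_eq] at h1 ⊢
  rw [abs_lt] at h1 ⊢
  rw [abs_le] at h3 h4
  constructor <;> linarith [h1.1, h1.2, h3.1, h3.2, h4.1, h4.2]

/-- The piecewise linear function with value `1` at `s` and `0` outside of `(s - δ, s + δ)`. -/
noncomputable def hat (δ s x : ℝ) : ℝ :=
  δ⁻¹ * (max (s + δ - x) 0 + -2 * max (s - x) 0 + max (s - δ - x) 0)

theorem hat_nonneg {δ : ℝ} (hδ : 0 < δ) (s x : ℝ) : 0 ≤ hat δ s x := by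
  refine mul_nonneg (inv_nonneg.2 hδ.le) ?_
  rcases max_cases (s + δ - x) 0 with h1 | h1 <;> rcases max_cases (s - x) 0 with h2 | h2 <;>
    rcases max_cases (s - δ - x) 0 with h3 | h3 <;> linarith

theorem abs_sub_lt_of_hat_ne_zero {δ : ℝ} (hδ : 0 < δ) {s x : ℝ} (h : hat δ s x ≠ 0) :
    |s - x| < δ := by
  by_contra hcon
  rw [not_lt, le_abs] at hcon
  apply h
  rw [hat]
  rcases hcon with hcon | hcon
  · rw [max_eq_left (by linarith), max_eq_left (by linarith), max_eq_left (by linarith)]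
    ring
  · rw [max_eq_right (by linarith), max_eq_right (by linarith), max_eq_right (by linarith)]
    ring

/-- Each hat is a second difference of puts with step `δ`, so the sum telescopes. -/
theorem sum_hat {δ : ℝ} (a x : ℝ) (N : ℕ) :
    ∑ n ∈ Finset.range (N + 1), hat δ (a + n * δ) x =
      δ⁻¹ * ((max (a + N * δ + δ - x) 0 - max (a + N * δ - x) 0)
        - (max (a - x) 0 - max (a - δ - x) 0)) := by
  induction N with
  | zero =>
    simp [hat]
    ring_nf
    simp
  | succ N ih =>
    rw [Finset.sum_range_succ, ih, hat, ← mul_add]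
    have e1 : a + ((N + 1 : ℕ) : ℝ) * δ = a + N * δ + δ := by push_cast; ring
    rw [e1, add_sub_cancel_right]
    ring

theorem sum_hat_eq_one {δ : ℝ} (hδ : 0 < δ) {a x : ℝ} {N : ℕ} (ha : a ≤ x)
    (hx : x ≤ a + N * δ) : ∑ n ∈ Finset.range (N + 1), hat δ (a + n * δ) x = 1 := by
  rw [sum_hat, max_eq_left (by linarith), max_eq_left (by linarith), max_eq_right (by linarith),
    max_eq_right (by linarith)]
  field_simp
  ring

theorem sum_hat_le_one {δ : ℝ} (hδ : 0 < δ) (a x : ℝ) (N : ℕ) :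
    ∑ n ∈ Finset.range (N + 1), hat δ (a + n * δ) x ≤ 1 := by
  rw [sum_hat, inv_mul_le_iff₀ hδ, mul_one]
  have h1 : max (a + N * δ + δ - x) 0 ≤ max (a + N * δ - x) 0 + δ :=
    max_le (by linarith [le_max_left (a + N * δ - x) 0])
      (by linarith [le_max_right (a + N * δ - x) 0])
  have h2 : max (a - δ - x) 0 ≤ max (a - x) 0 := max_le_max_right _ (by linarith)
  linarith

/-- Interpolate `f` at equally spaced nodes from -2r to 2r, finely enough for uniform continuity.
For |x| > 2r the error is at most C(2 + |x| + 2r) ≤ 8C(|x| - r), using r ≥ 1. -/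
theorem exists_sum_hat_approx {f : ℝ → ℝ} (hf : Continuous f) {C : ℝ} (hC0 : 0 ≤ C)
    (hC : ∀ x, |f x| ≤ C * (1 + |x|)) {ε : ℝ} (hε : 0 < ε) {r : ℝ} (hr : 1 ≤ r) :
    ∃ (δ a : ℝ) (N : ℕ), ∀ x,
      |f x - ∑ n ∈ Finset.range N, f (a + n * δ) * hat δ (a + n * δ) x| ≤
        ε + 8 * C * (max (x - r) 0 + max (-r - x) 0) := by
  have huc : UniformContinuousOn f (Icc (-(2 * r)) (2 * r)) :=
    isCompact_Icc.uniformContinuousOn_of_continuous hf.continuousOn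
  obtain ⟨d, hd, hfd⟩ := Metric.uniformContinuousOn_iff.1 huc ε hε
  obtain ⟨n, hn⟩ := exists_nat_gt (4 * r / d)
  have hn0 : (0 : ℝ) < n := lt_trans (by positivity) hn
  set δ := 4 * r / n with hδdef
  have hδ : 0 < δ := by positivity
  have hδd : δ < d := by
    rw [div_lt_iff₀ hd] at hn
    rw [hδdef, div_lt_iff₀ hn0]
    linarith
  have hnδ : -(2 * r) + n * δ = 2 * r := by
    rw [hδdef]
    field_simp
    ring
  have hmem : ∀ k ∈ Finset.range (n + 1), -(2 * r) + k * δ ∈ Icc (-(2 * r)) (2 * r) := by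
    intro k hk
    have hk' : (k : ℝ) ≤ n := by exact_mod_cast Finset.mem_range_succ_iff.1 hk
    have := mul_le_mul_of_nonneg_right hk' hδ.le
    constructor
    · have : 0 ≤ (k : ℝ) * δ := by positivity
      linarith
    · linarith
  refine ⟨δ, -(2 * r), n + 1, fun x => ?_⟩
  have htail : 0 ≤ max (x - r) 0 + max (-r - x) 0 :=
    add_nonneg (le_max_right _ _) (le_max_right _ _)
  by_cases hx : x ∈ Icc (-(2 * r)) (2 * r)
  · have h1 : f x = ∑ k ∈ Finset.range (n + 1), f x * hat δ (-(2 * r) + k * δ) x := by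
      rw [← Finset.mul_sum, sum_hat_eq_one hδ hx.1 (hx.2.trans_eq hnδ.symm), mul_one]
    have h2 : |f x - ∑ k ∈ Finset.range (n + 1),
        f (-(2 * r) + k * δ) * hat δ (-(2 * r) + k * δ) x| ≤ ε := by
      conv_lhs => rw [h1]
      rw [← Finset.sum_sub_distrib]
      refine (Finset.abs_sum_le_sum_abs _ _).trans ?_
      calc _ ≤ ∑ k ∈ Finset.range (n + 1), ε * hat δ (-(2 * r) + k * δ) x := by
            refine Finset.sum_le_sum fun k hk => ?_
            rw [← sub_mul, abs_mul, abs_of_nonneg (hat_nonneg hδ _ _)]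
            by_cases h0 : hat δ (-(2 * r) + k * δ) x = 0
            · simp [h0]
            · refine mul_le_mul_of_nonneg_right ?_ (hat_nonneg hδ _ _)
              have hlt := abs_sub_lt_of_hat_ne_zero hδ h0
              refine (hfd x hx _ (hmem k hk) ?_).le
              rw [dist_comm, Real.dist_eq]
              exact hlt.trans hδd
        _ ≤ ε := by
            rw [← Finset.mul_sum]
            exact mul_le_of_le_one_right hε.le (sum_hat_le_one hδ _ _ _)
    have : 0 ≤ 8 * C * (max (x - r) 0 + max (-r - x) 0) := by positivity
    linarith
  · have hxr : 2 * r < |x| := by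
      rw [lt_abs]
      by_contra hcon
      push Not at hcon
      exact hx ⟨by linarith [hcon.2], hcon.1⟩
    have h2 : |∑ k ∈ Finset.range (n + 1),
        f (-(2 * r) + k * δ) * hat δ (-(2 * r) + k * δ) x| ≤ C * (1 + 2 * r) := by
      refine (Finset.abs_sum_le_sum_abs _ _).trans ?_
      calc _ ≤ ∑ k ∈ Finset.range (n + 1), C * (1 + 2 * r) * hat δ (-(2 * r) + k * δ) x := by
            refine Finset.sum_le_sum fun k hk => ?_
            rw [abs_mul, abs_of_nonneg (hat_nonneg hδ _ _)]
            refine mul_le_mul_of_nonneg_right ((hC _).trans ?_) (hat_nonneg hδ _ _)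
            exact mul_le_mul_of_nonneg_left (by linarith [abs_le.2 (hmem k hk)]) hC0
        _ ≤ C * (1 + 2 * r) := by
            rw [← Finset.mul_sum]
            exact mul_le_of_le_one_right (by positivity) (sum_hat_le_one hδ _ _ _)
    have h3 := (abs_sub (f x) (∑ k ∈ Finset.range (n + 1),
        f (-(2 * r) + k * δ) * hat δ (-(2 * r) + k * δ) x)).trans (add_le_add (hC x) h2)
    have h4 : |x| - r ≤ max (x - r) 0 + max (-r - x) 0 := by
      rcases abs_cases x with ⟨h, _⟩ | ⟨h, _⟩ <;> rw [h]
      · linarith [le_max_left (x - r) 0, le_max_right (-r - x) 0]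
      · linarith [le_max_right (x - r) 0, le_max_left (-r - x) 0]
    have h5 : C * (1 + |x|) + C * (1 + 2 * r)
        ≤ 8 * C * (max (x - r) 0 + max (-r - x) 0) := by
      have : 1 + |x| + (1 + 2 * r) ≤ 8 * (max (x - r) 0 + max (-r - x) 0) := by linarith
      nlinarith [mul_le_mul_of_nonneg_left this hC0]
    linarith

/-- Convergence of masses, barycenters and potential functions implies convergence of the integrals
of all continuous functions of at most linear growth. -/
theorem tendsto_integral_of_tendsto_put (hη : ∀ᶠ i in l, FiniteFirstMoment (η i))
    (hθ : FiniteFirstMoment θ) (hmass : Tendsto (fun i => (η i).real univ) l (𝓝 (θ.real univ)))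
    (hmean : Tendsto (fun i => ∫ y, y ∂(η i)) l (𝓝 (∫ y, y ∂θ)))
    (hput : ∀ t, Tendsto (fun i => put (η i) t) l (𝓝 (put θ t)))
    {f : ℝ → ℝ} (hf : Continuous f) {C : ℝ} (hC : ∀ x, |f x| ≤ C * (1 + |x|)) :
    Tendsto (fun i => ∫ x, f x ∂(η i)) l (𝓝 (∫ x, f x ∂θ)) := by
  have hC0 : 0 ≤ C := by
    have := (abs_nonneg _).trans (hC 0)
    simpa using this
  have cput : ∀ t, ConvergesOn l η θ (fun y => max (t - y) 0) := fun t =>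
    ⟨⟨by fun_prop, _, linear_growth_put t⟩, hput t⟩
  have cconst : ∀ c : ℝ, ConvergesOn l η θ (fun _ => c) := fun c =>
    ⟨⟨continuous_const, |c|, fun x => by nlinarith [abs_nonneg c, abs_nonneg x]⟩, by
      simpa using hmass.mul_const c⟩
  have cid : ConvergesOn l η θ (fun y => y) :=
    ⟨⟨continuous_id, 1, fun x => by linarith⟩, hmean⟩
  have ccall : ∀ t, ConvergesOn l η θ (fun y => max (y - t) 0) := by
    intro t
    have h : (fun y => max (y - t) 0) = fun y => max (t - y) 0 + y + -t := by
      funext y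
      rcases le_total y t with h | h
      · rw [max_eq_right (by linarith), max_eq_left (by linarith)]; ring
      · rw [max_eq_left (by linarith), max_eq_right (by linarith)]; ring
    rw [h]
    exact ((cput t).add hη hθ cid).add hη hθ (cconst _)
  have chat : ∀ δ s, ConvergesOn l η θ (hat δ s) := fun δ s =>
    ((((cput (s + δ)).add hη hθ ((cput s).const_mul (-2))).add hη hθ (cput (s - δ))).const_mul δ⁻¹)
  have htail : Tendsto (fun r => 8 * C * (∫ y, max (y - r) 0 ∂θ + put θ (-r))) atTop (𝓝 0) := by
    have h1 := tendsto_put_atTop hθ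
    simp only [← integral_call hθ] at h1
    have h2 := (tendsto_put_atBot hθ).comp tendsto_neg_atTop_atBot
    simpa using (h1.add h2).const_mul (8 * C)
  refine (ConvergesOn.of_approx hη hθ hf hC fun ε hε => ?_).2
  obtain ⟨r, hr1, hr⟩ := ((eventually_ge_atTop 1).and
    (htail.eventually_lt_const (half_pos hε))).exists
  set M := θ.real univ with hM
  have hM0 : 0 ≤ M := measureReal_nonneg
  -- `r` bounds the tail term by ε/2. The constant error contributes at most ε/2 after integration;
  -- `M + 1` also covers zero mass.
  obtain ⟨δ, a, N, happ⟩ := exists_sum_hat_approx hf hC0 hC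
    (show 0 < ε / (2 * (M + 1)) by positivity) hr1
  refine ⟨_, _, ConvergesOn.sum hη hθ (fun n => (chat δ (a + n * δ)).const_mul (f (a + n * δ))) N,
    (cconst _).add hη hθ (((ccall r).add hη hθ (cput (-r))).const_mul (8 * C)), happ, ?_⟩
  have := hθ.1
  have hi : Integrable (fun x => 8 * C * (max (x - r) 0 + max (-r - x) 0)) θ :=
    ((hθ.integrable_call r).add (hθ.integrable_put (-r))).const_mul (8 * C)
  rw [integral_add (integrable_const _) hi,
    integral_const_mul, integral_add (hθ.integrable_call r) (hθ.integrable_put (-r)),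
    integral_const, smul_eq_mul]
  have h1 : M * (ε / (2 * (M + 1))) ≤ ε / 2 := by
    rw [mul_div_assoc', div_le_div_iff₀ (by positivity) (by positivity)]
    nlinarith
  change 8 * C * (∫ y, max (y - r) 0 ∂θ + put θ (-r)) < _ at hr
  change _ + 8 * C * (∫ y, max (y - r) 0 ∂θ + put θ (-r)) ≤ _
  linarith

end Convergence

/-! ### The Kellerer dilation -/

section Kernel

variable {S : Set ℝ}

theorem sSup_inter_Iic_mem (hS : IsClosed S) (hlo : ∀ x, ∃ y ∈ S, y ≤ x) (x : ℝ) :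
    sSup (S ∩ Iic x) ∈ S ∩ Iic x := by
  obtain ⟨y, hy, hyx⟩ := hlo x
  exact (hS.inter isClosed_Iic).csSup_mem ⟨y, hy, hyx⟩ ⟨x, fun z hz => hz.2⟩

theorem sInf_inter_Ici_mem (hS : IsClosed S) (hhi : ∀ x, ∃ y ∈ S, x ≤ y) (x : ℝ) :
    sInf (S ∩ Ici x) ∈ S ∩ Ici x := by
  obtain ⟨y, hy, hyx⟩ := hhi x
  exact (hS.inter isClosed_Ici).csInf_mem ⟨y, hy, hyx⟩ ⟨x, fun z hz => hz.2⟩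

theorem monotone_sSup_inter_Iic (hS : IsClosed S) (hlo : ∀ x, ∃ y ∈ S, y ≤ x) :
    Monotone fun x => sSup (S ∩ Iic x) := fun a b hab =>
  le_csSup ⟨b, fun _ hz => hz.2⟩
    ⟨(sSup_inter_Iic_mem hS hlo a).1, (sSup_inter_Iic_mem hS hlo a).2.trans hab⟩

theorem monotone_sInf_inter_Ici (hS : IsClosed S) (hhi : ∀ x, ∃ y ∈ S, x ≤ y) :
    Monotone fun x => sInf (S ∩ Ici x) := fun a b hab =>
  csInf_le ⟨a, fun _ hz => hz.2⟩
    ⟨(sInf_inter_Ici_mem hS hhi b).1, hab.trans (sInf_inter_Ici_mem hS hhi b).2⟩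

/-- Outside of `S`, a point is a strict convex combination of the neighbouring points of `S`, and
the calls and puts struck in `S` are affine in between. -/
theorem exists_kellererKernel_eq (hS : IsClosed S) (hlo : ∀ x, ∃ y ∈ S, y ≤ x)
    (hhi : ∀ x, ∃ y ∈ S, x ≤ y) {x : ℝ} (hx : x ∉ S) :
    ∃ a b p q : ℝ, a ∈ S ∧ b ∈ S ∧ 0 ≤ p ∧ 0 ≤ q ∧ p + q = 1 ∧
      kellererKernel S x = ENNReal.ofReal p • Measure.dirac a + ENNReal.ofReal q • Measure.dirac b ∧
      (∀ y ∈ S, max (x - y) 0 = p * max (a - y) 0 + q * max (b - y) 0) ∧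
      (∀ y ∈ S, max (y - x) 0 = p * max (y - a) 0 + q * max (y - b) 0) := by
  obtain ⟨haS, hax⟩ := sSup_inter_Iic_mem hS hlo x
  obtain ⟨hbS, hxb⟩ := sInf_inter_Ici_mem hS hhi x
  have hkey := kellererKernel.eq_1 S x
  rw [if_neg hx] at hkey
  have hle : ∀ y ∈ S, y ≤ sSup (S ∩ Iic x) ∨ sInf (S ∩ Ici x) ≤ y := by
    intro y hy
    rcases le_total y x with h | h
    · exact Or.inl (le_csSup ⟨x, fun _ hz => hz.2⟩ ⟨hy, h⟩)
    · exact Or.inr (csInf_le ⟨x, fun _ hz => hz.2⟩ ⟨hy, h⟩)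
  set a := sSup (S ∩ Iic x)
  set b := sInf (S ∩ Ici x)
  have hax' : a < x := lt_of_le_of_ne hax fun h => hx (h ▸ haS)
  have hxb' : x < b := lt_of_le_of_ne hxb fun h => hx (h ▸ hbS)
  have hab : 0 < b - a := by linarith
  refine ⟨a, b, (b - x) / (b - a), (x - a) / (b - a), haS, hbS,
    div_nonneg (by linarith) hab.le, div_nonneg (by linarith) hab.le, by field_simp; ring, hkey,
    ?_, ?_⟩
  · intro y hy
    rcases hle y hy with h | h
    · rw [max_eq_left (by linarith), max_eq_left (by linarith), max_eq_left (by linarith)]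
      field_simp
      ring
    · rw [max_eq_right (by linarith), max_eq_right (by linarith), max_eq_right (by linarith)]
      ring
  · intro y hy
    rcases hle y hy with h | h
    · rw [max_eq_right (by linarith), max_eq_right (by linarith), max_eq_right (by linarith)]
      ring
    · rw [max_eq_left (by linarith), max_eq_left (by linarith), max_eq_left (by linarith)]
      field_simp
      ring

theorem measurable_kellererKernel (hS : IsClosed S) (hlo : ∀ x, ∃ y ∈ S, y ≤ x)
    (hhi : ∀ x, ∃ y ∈ S, x ≤ y) : Measurable (kellererKernel S) := by
  classical
  have m1 := (monotone_sSup_inter_Iic hS hlo).measurable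
  have m2 := (monotone_sInf_inter_Ici hS hhi).measurable
  refine Measure.measurable_of_measurable_coe _ fun A hA => ?_
  have hdir : ∀ g : ℝ → ℝ, Measurable g → Measurable fun x => Measure.dirac (g x) A := fun g hg =>
    (Measure.measurable_coe hA).comp (Measure.measurable_dirac.comp hg)
  have heq : (fun x => kellererKernel S x A) = S.piecewise (fun x => Measure.dirac x A)
      (fun x => ENNReal.ofReal ((sInf (S ∩ Ici x) - x) / (sInf (S ∩ Ici x) - sSup (S ∩ Iic x))) *
          Measure.dirac (sSup (S ∩ Iic x)) A +
        ENNReal.ofReal ((x - sSup (S ∩ Iic x)) / (sInf (S ∩ Ici x) - sSup (S ∩ Iic x))) *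
          Measure.dirac (sInf (S ∩ Ici x)) A) := by
    funext x
    by_cases hx : x ∈ S <;> simp [kellererKernel, hx, piecewise]
  rw [heq]
  refine Measurable.piecewise hS.measurableSet (hdir _ measurable_id) ?_
  exact ((((m2.sub measurable_id).div (m2.sub m1)).ennreal_ofReal).mul (hdir _ m1)).add
    ((((measurable_id.sub m1).div (m2.sub m1)).ennreal_ofReal).mul (hdir _ m2))

/-- Lower integrals allow `Measure.lintegral_bind` before anything is known to be integrable for the
projection. -/
theorem lintegral_kellererKernel (hS : IsClosed S) (hlo : ∀ x, ∃ y ∈ S, y ≤ x)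
    (hhi : ∀ x, ∃ y ∈ S, x ≤ y) (x : ℝ) :
    kellererKernel S x univ = 1 ∧ kellererKernel S x Sᶜ = 0 ∧
      (∀ t ∈ S, ∫⁻ y, ENNReal.ofReal (t - y) ∂(kellererKernel S x) = ENNReal.ofReal (t - x)) ∧
      (∀ t ∈ S, ∫⁻ y, ENNReal.ofReal (y - t) ∂(kellererKernel S x) = ENNReal.ofReal (x - t)) := by
  by_cases hx : x ∈ S
  · have : kellererKernel S x = Measure.dirac x := if_pos hx
    simp [this, hx]
  · obtain ⟨a, b, p, q, ha, hb, hp, hq, hpq, hk, h1, h2⟩ := exists_kellererKernel_eq hS hlo hhi hx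
    have hl : ∀ g : ℝ → ℝ, ∫⁻ y, ENNReal.ofReal (g y) ∂(kellererKernel S x)
        = ENNReal.ofReal (p * max (g a) 0 + q * max (g b) 0) := by
      intro g
      rw [hk, lintegral_add_measure, lintegral_smul_measure, lintegral_smul_measure,
        lintegral_dirac, lintegral_dirac, smul_eq_mul, smul_eq_mul,
        ENNReal.ofReal_add (mul_nonneg hp (le_max_right _ _)) (mul_nonneg hq (le_max_right _ _)),
        ENNReal.ofReal_mul hp, ENNReal.ofReal_mul hq, ofReal_max_zero, ofReal_max_zero]
    refine ⟨?_, ?_, ?_, ?_⟩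
    · rw [hk]
      simp [← ENNReal.ofReal_add hp hq, hpq]
    · rw [hk]
      simp [ha, hb]
    · intro t ht
      rw [hl, ← h2 t ht, ofReal_max_zero]
    · intro t ht
      rw [hl, ← h1 t ht, ofReal_max_zero]

variable {m : Measure ℝ}

/-- The kernel preserves calls and puts struck in `S`. At one `t₀ ∈ S` their sum is |y - t₀|, which
gives integrability, and parity there gives the barycenter. -/
theorem bind_kellererKernel (hS : IsClosed S) (hlo : ∀ x, ∃ y ∈ S, y ≤ x)
    (hhi : ∀ x, ∃ y ∈ S, x ≤ y) (hm : FiniteFirstMoment m) :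
    FiniteFirstMoment (m.bind (kellererKernel S)) ∧
      (m.bind (kellererKernel S)) Sᶜ = 0 ∧
      (m.bind (kellererKernel S)).real univ = m.real univ ∧
      ∫ y, y ∂(m.bind (kellererKernel S)) = ∫ y, y ∂m ∧
      ∀ t ∈ S, put (m.bind (kellererKernel S)) t = put m t := by
  have hmeas := (measurable_kellererKernel hS hlo hhi).aemeasurable (μ := m)
  have hl := lintegral_kellererKernel hS hlo hhi
  set θ := m.bind (kellererKernel S)
  have huniv : θ univ = m univ := by
    rw [Measure.bind_apply MeasurableSet.univ hmeas]
    simp only [fun x => (hl x).1]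
    simp
  have hcompl : θ Sᶜ = 0 := by
    rw [Measure.bind_apply hS.measurableSet.compl hmeas]
    simp only [fun x => (hl x).2.1]
    simp
  have hright : ∀ t ∈ S, ∫⁻ y, ENNReal.ofReal (t - y) ∂θ = ∫⁻ y, ENNReal.ofReal (t - y) ∂m := by
    intro t ht
    rw [Measure.lintegral_bind hmeas (by fun_prop)]
    exact lintegral_congr fun x => (hl x).2.2.1 t ht
  have hleft : ∀ t ∈ S, ∫⁻ y, ENNReal.ofReal (y - t) ∂θ = ∫⁻ y, ENNReal.ofReal (y - t) ∂m := by
    intro t ht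
    rw [Measure.lintegral_bind hmeas (by fun_prop)]
    exact lintegral_congr fun x => (hl x).2.2.2 t ht
  have := hm.1
  have hfin : IsFiniteMeasure θ := ⟨by rw [huniv]; exact measure_lt_top _ _⟩
  obtain ⟨t₀, ht₀, -⟩ := hlo 0
  have hθ : FiniteFirstMoment θ := by
    refine ⟨hfin, ?_⟩
    have h1 : Integrable (fun y : ℝ => y - t₀) θ := by
      refine ⟨by fun_prop, ?_⟩
      rw [hasFiniteIntegral_iff_norm]
      have hle : ∀ y : ℝ, ENNReal.ofReal ‖y - t₀‖
          ≤ ENNReal.ofReal (y - t₀) + ENNReal.ofReal (t₀ - y) := by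
        intro y
        rcases le_total y t₀ with h | h
        · rw [Real.norm_eq_abs, abs_of_nonpos (by linarith), neg_sub]
          exact le_add_self
        · rw [Real.norm_eq_abs, abs_of_nonneg (by linarith)]
          exact le_self_add
      refine (lintegral_mono hle).trans_lt ?_
      rw [lintegral_add_left (by fun_prop), hright t₀ ht₀, hleft t₀ ht₀,
        lintegral_ofReal_sub_left hm, lintegral_ofReal_sub_right hm]
      exact ENNReal.add_lt_top.2 ⟨ENNReal.ofReal_lt_top, ENNReal.ofReal_lt_top⟩
    exact (h1.add (integrable_const t₀)).congr (Eventually.of_forall fun y => by simp)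
  have hput : ∀ t ∈ S, put θ t = put m t := by
    intro t ht
    have h := hright t ht
    rw [lintegral_ofReal_sub_right hm, lintegral_ofReal_sub_right hθ] at h
    exact (ENNReal.ofReal_eq_ofReal_iff (put_nonneg _ _) (put_nonneg _ _)).1 h
  have hmass : θ.real univ = m.real univ := by rw [measureReal_def, huniv, measureReal_def]
  refine ⟨hθ, hcompl, hmass, ?_, hput⟩
  have h := hleft t₀ ht₀
  rw [lintegral_ofReal_sub_left hm, lintegral_ofReal_sub_left hθ,
    ENNReal.ofReal_eq_ofReal_iff (by linarith [le_put hθ t₀]) (by linarith [le_put hm t₀]),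
    hput t₀ ht₀, hmass] at h
  linarith

/-- The points and weights do not depend on `μ`, so convergence of potentials of measures carried by
`S` extends from `S` into its gaps. -/
theorem put_eq_of_compl_null (hS : IsClosed S) (hlo : ∀ x, ∃ y ∈ S, y ≤ x)
    (hhi : ∀ x, ∃ y ∈ S, x ≤ y) {x : ℝ} (hx : x ∉ S) :
    ∃ a ∈ S, ∃ b ∈ S, ∃ p q : ℝ, ∀ μ : Measure ℝ, FiniteFirstMoment μ → μ Sᶜ = 0 →
      put μ x = p * put μ a + q * put μ b := by
  obtain ⟨a, b, p, q, ha, hb, -, -, -, -, h1, -⟩ := exists_kellererKernel_eq hS hlo hhi hx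
  refine ⟨a, ha, b, hb, p, q, fun μ hμ hμS => ?_⟩
  rw [put, put, put, ← integral_const_mul, ← integral_const_mul,
    ← integral_add ((hμ.integrable_put a).const_mul p) ((hμ.integrable_put b).const_mul q)]
  refine integral_congr_ae ?_
  filter_upwards [compl_mem_ae_iff.2 hμS] with y hy
  rw [compl_compl] at hy
  exact h1 y hy

end Kernel

/-! ### The extended set and the hull of the support -/

theorem isClosed_extendSet (T : Set ℝ) : IsClosed (extendSet T) :=
  ((isClosed_Iic.preimage continuous_coe_real_ereal).union isClosed_closure).union
    (isClosed_Ici.preimage continuous_coe_real_ereal)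

theorem exists_mem_extendSet_le (T : Set ℝ) (x : ℝ) : ∃ y ∈ extendSet T, y ≤ x := by
  by_cases hx : (x : EReal) ≤ einf T
  · exact ⟨x, Or.inl (Or.inl hx), le_rfl⟩
  · obtain ⟨_, ⟨y, hy, rfl⟩, hyx⟩ := sInf_lt_iff.1 (not_le.1 hx)
    exact ⟨y, Or.inl (Or.inr (subset_closure hy)), (EReal.coe_lt_coe_iff.1 hyx).le⟩

theorem exists_mem_extendSet_ge (T : Set ℝ) (x : ℝ) : ∃ y ∈ extendSet T, x ≤ y := by
  by_cases hx : esup T ≤ (x : EReal)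
  · exact ⟨x, Or.inr hx, le_rfl⟩
  · obtain ⟨_, ⟨y, hy, rfl⟩, hyx⟩ := lt_sSup_iff.1 (not_le.1 hx)
    exact ⟨y, Or.inl (Or.inr (subset_closure hy)), (EReal.coe_lt_coe_iff.1 hyx).le⟩

theorem ae_mem_of_le {η ν : Measure ℝ} (h : η ≤ ν) : ∀ᵐ y ∂η, y ∈ ν.support :=
  (Measure.absolutelyContinuous_of_le h).ae_le Measure.support_mem_ae

theorem put_eq_zero_of_le_einf {η : Measure ℝ} {T : Set ℝ} (h : ∀ᵐ y ∂η, y ∈ T) {t : ℝ}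
    (ht : (t : EReal) ≤ einf T) : put η t = 0 := by
  refine integral_eq_zero_of_ae ?_
  filter_upwards [h] with y hy
  have : t ≤ y := EReal.coe_le_coe_iff.1 (ht.trans (sInf_le ⟨y, hy, rfl⟩))
  exact max_eq_right (by linarith)

theorem integral_call_eq_zero_of_esup_le {η : Measure ℝ} {T : Set ℝ} (h : ∀ᵐ y ∂η, y ∈ T) {t : ℝ}
    (ht : esup T ≤ (t : EReal)) : ∫ y, max (y - t) 0 ∂η = 0 := by
  refine integral_eq_zero_of_ae ?_
  filter_upwards [h] with y hy
  have : y ≤ t := EReal.coe_le_coe_iff.1 ((le_sSup ⟨y, hy, rfl⟩ : (y : EReal) ≤ esup T).trans ht)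
  exact max_eq_right (by linarith)

theorem ConvexLE.integral_call_le {σ η : Measure ℝ} (h : ConvexLE σ η) (t : ℝ) :
    ∫ y, max (y - t) 0 ∂σ ≤ ∫ y, max (y - t) 0 ∂η := by
  rw [integral_call h.1, integral_call h.2.1, h.measureReal_univ, h.integral_id]
  exact sub_le_sub_right (h.put_le t) _

/-- Potential functions of measures in convex order agree outside of the convex hull of a set that
carries the larger measure. -/
theorem ConvexLE.put_eq_of_notMem {σ η : Measure ℝ} (h : ConvexLE σ η) {T : Set ℝ}
    (hT : ∀ᵐ y ∂η, y ∈ T) {t : ℝ} (ht : (t : EReal) ≤ einf T ∨ esup T ≤ (t : EReal)) :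
    put η t = put σ t := by
  rcases ht with ht | ht
  · have h1 := put_eq_zero_of_le_einf hT ht
    have h2 := h.put_le t
    have h3 := put_nonneg σ t
    linarith
  · have h1 := integral_call_eq_zero_of_esup_le hT ht
    have h2 := h.integral_call_le t
    have h3 : 0 ≤ ∫ y, max (y - t) 0 ∂σ := integral_nonneg fun _ => le_max_right _ _
    rw [integral_call h.1] at h2 h3
    rw [integral_call h.2.1] at h1 h2
    rw [h.measureReal_univ, h.integral_id] at h2 h3
    linarith

theorem measure_eq_zero_of_integral_max_eq_zero {m : Measure ℝ} {g : ℝ → ℝ}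
    (hg : Integrable (fun y => max (g y) 0) m) (h : ∫ y, max (g y) 0 ∂m = 0) :
    m {y | 0 < g y} = 0 := by
  have h1 := (integral_eq_zero_iff_of_nonneg (fun y => le_max_right (g y) 0) hg).1 h
  refine measure_mono_null (fun y hy => ?_) h1
  intro h0
  have hy' : 0 < g y := hy
  exact absurd (h0 : max (g y) 0 = 0) (lt_of_lt_of_le hy' (le_max_left _ _)).ne'

/-- If x < inf T, a real z strictly between has `put m z = 0`, so ]-∞, z[ is an m-null neighbourhood
of x; calls handle the other side. -/
theorem support_subset_hull {m : Measure ℝ} (hm : FiniteFirstMoment m) {T : Set ℝ}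
    (h1 : ∀ t : ℝ, (t : EReal) ≤ einf T → put m t = 0)
    (h2 : ∀ t : ℝ, esup T ≤ (t : EReal) → ∫ y, max (y - t) 0 ∂m = 0) : m.support ⊆ hull T := by
  intro x hx
  rw [Measure.mem_support_iff_forall] at hx
  constructor
  · by_contra hcon
    obtain ⟨z, hxz, hz⟩ := EReal.lt_iff_exists_real_btwn.1 (not_le.1 hcon)
    have hz0 := measure_eq_zero_of_integral_max_eq_zero (hm.integrable_put z) (h1 z hz.le)
    refine (hx _ ?_).ne' hz0
    exact (isOpen_lt continuous_const (by fun_prop)).mem_nhds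
      (sub_pos.2 (EReal.coe_lt_coe_iff.1 hxz))
  · by_contra hcon
    obtain ⟨z, hz, hxz⟩ := EReal.lt_iff_exists_real_btwn.1 (not_le.1 hcon)
    have hz0 := measure_eq_zero_of_integral_max_eq_zero (hm.integrable_call z) (h2 z hz.le)
    refine (hx _ ?_).ne' hz0
    exact (isOpen_lt continuous_const (by fun_prop)).mem_nhds
      (sub_pos.2 (EReal.coe_lt_coe_iff.1 hxz))

/-! ### Rescaled shadows and their limit -/

theorem hasRightDerivative_iff {θ : ℝ → Measure ℝ} {m : Measure ℝ} {u₀ : ℝ} :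
    HasRightDerivative θ m u₀ ↔ FiniteFirstMoment m ∧
      ∀ f : ℝ → ℝ, Continuous f → (∃ C : ℝ, ∀ x, |f x| ≤ C * (1 + |x|)) →
        Tendsto (fun u => (u - u₀)⁻¹ * (∫ x, f x ∂(θ u) - ∫ x, f x ∂(θ u₀))) (𝓝[>] u₀)
          (𝓝 (∫ x, f x ∂m)) := by
  refine and_congr_right fun _ => forall₃_congr fun f _ _ => ?_
  rw [← hasDerivWithinAt_Ioi_iff_Ici, hasDerivWithinAt_iff_tendsto_slope' (by simp)]
  simp only [slope_fun_def, smul_eq_mul, vsub_eq_sub]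

/-- Convergence of rescaled shadows to the hitting projection. Here `η u` has the potential function
of the shadow of `σ u` in `ν`, and the measures `σ u`, rescaled by `s u`, converge to `m` while
their masses vanish. -/
theorem tendsto_shadow_hittingProjection {ι : Type*} {l : Filter ι} {ν m : Measure ℝ}
    (hν : FiniteFirstMoment ν) (hm : FiniteFirstMoment m) {σ η : ι → Measure ℝ} {s : ι → ℝ}
    (hs : ∀ i, 0 ≤ s i) (hle : ∀ᶠ i in l, η i ≤ ν) (hση : ∀ᶠ i in l, ConvexLE (σ i) (η i))
    (hput : ∀ᶠ i in l, put (η i) = put ν - envelope (put ν - put (σ i)))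
    (hmass0 : Tendsto (fun i => (σ i).real univ) l (𝓝 0))
    (hmass : Tendsto (fun i => s i * (σ i).real univ) l (𝓝 (m.real univ)))
    (hmean : Tendsto (fun i => s i * ∫ y, y ∂(σ i)) l (𝓝 (∫ y, y ∂m)))
    (hσput : ∀ t, Tendsto (fun i => s i * put (σ i) t) l (𝓝 (put m t))) :
    FiniteFirstMoment (hittingProjection m ν.support) ∧
    ∀ f : ℝ → ℝ, Continuous f → (∃ C : ℝ, ∀ x, |f x| ≤ C * (1 + |x|)) →
      Tendsto (fun i => s i * ∫ x, f x ∂(η i)) l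
        (𝓝 (∫ x, f x ∂(hittingProjection m ν.support))) := by
  have hS := isClosed_extendSet ν.support
  have hlo := exists_mem_extendSet_le ν.support
  have hhi := exists_mem_extendSet_ge ν.support
  obtain ⟨hθ, hθS, hθmass, hθmean, hθput⟩ := bind_kellererKernel hS hlo hhi hm
  rw [← hittingProjection] at hθ hθS hθmass hθmean
  simp only [← hittingProjection.eq_1] at hθput
  refine ⟨hθ, ?_⟩
  set θ := hittingProjection m ν.support
  have := hν.1
  have hηS : ∀ᶠ i in l, (η i) (extendSet ν.support)ᶜ = 0 := by
    filter_upwards [hle] with i hi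
    refine measure_mono_null ?_ (ae_iff.1 (ae_mem_of_le hi))
    exact compl_subset_compl.2 fun y hy => Or.inl (Or.inr (subset_closure hy))
  have hconvS : ∀ t ∈ extendSet ν.support,
      Tendsto (fun i => s i * put (η i) t) l (𝓝 (put θ t)) := by
    intro t ht
    rw [hθput t ht]
    by_cases htT : t ∈ ν.support
    -- On the support, convex order gives the lower bound. For the upper one, fix a small δ: [t - δ,
    -- t + δ] has positive mass, eventually more than `σ i`, so `sub_envelope_le` costs 2δ times a
    -- rescaled mass that converges.
    · have hlow : ∀ᶠ i in l, s i * put (σ i) t ≤ s i * put (η i) t := by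
        filter_upwards [hση] with i hi
        exact mul_le_mul_of_nonneg_left (hi.put_le t) (hs i)
      rw [tendsto_order]
      refine ⟨fun a ha => ?_, fun b hb => ?_⟩
      · filter_upwards [hlow, (hσput t).eventually_const_lt ha] with i h1 h2
        exact h2.trans_le h1
      · obtain ⟨δ, hδ, hδb⟩ : ∃ δ > 0, put m t + 2 * δ * m.real univ < b := by
          have hc : Tendsto (fun δ : ℝ => put m t + 2 * δ * m.real univ) (𝓝[>] 0)
              (𝓝 (put m t + 2 * 0 * m.real univ)) :=
            tendsto_nhdsWithin_of_tendsto_nhds (Continuous.tendsto (by fun_prop) 0)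
          rw [mul_zero, zero_mul, add_zero] at hc
          obtain ⟨δ, h1, h2⟩ := ((hc.eventually_lt_const hb).and self_mem_nhdsWithin).exists
          exact ⟨δ, h2, h1⟩
        have hpos : 0 < ν.real (Icc (t - δ) (t + δ)) := by
          rw [measureReal_def]
          exact ENNReal.toReal_pos
            ((Measure.mem_support_iff_forall t).1 htT _
              (Icc_mem_nhds (by linarith) (by linarith))).ne' (measure_ne_top _ _)
        have hlim := ((hσput t).add (hmass.const_mul (2 * δ))).eventually_lt_const hδb
        filter_upwards [hση, hput, hmass0.eventually_lt_const hpos, hlim] with i h1 h2 h3 h4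
        have h5 := sub_envelope_le h1.1 hν (le_of_lt hδ) h3.le
        have h6 : put (η i) t ≤ put (σ i) t + 2 * (σ i).real univ * δ := by
          rw [h2]
          exact h5
        have h7 := mul_le_mul_of_nonneg_left h6 (hs i)
        linarith
    · have ht' : (t : EReal) ≤ einf ν.support ∨ esup ν.support ≤ (t : EReal) := by
        rcases ht with (h | h) | h
        · exact Or.inl h
        · rw [Measure.isClosed_support.closure_eq] at h
          exact absurd h htT
        · exact Or.inr h
      refine (hσput t).congr' ?_
      filter_upwards [hle, hση] with i h1 h2
      rw [h2.put_eq_of_notMem (ae_mem_of_le h1) ht']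
  have hconv : ∀ t, Tendsto (fun i => s i * put (η i) t) l (𝓝 (put θ t)) := by
    intro t
    by_cases ht : t ∈ extendSet ν.support
    · exact hconvS t ht
    -- In a gap, `θ` and all eventual `η i` interpolate with the same weights.
    · obtain ⟨a, ha, b, hb, p, q, hpq⟩ := put_eq_of_compl_null hS hlo hhi ht
      rw [hpq θ hθ hθS]
      refine (((hconvS a ha).const_mul p).add ((hconvS b hb).const_mul q)).congr' ?_
      filter_upwards [hση, hηS] with i h1 h2
      rw [hpq _ h1.2.1 h2]
      ring
  rintro f hf ⟨C, hC⟩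
  have key := tendsto_integral_of_tendsto_put (l := l) (η := fun i => ENNReal.ofReal (s i) • η i)
    (θ := θ) (by filter_upwards [hση] with i hi using hi.2.1.smul _) hθ
    (by
      rw [hθmass]
      refine hmass.congr' ?_
      filter_upwards [hση] with i hi
      rw [hi.measureReal_univ, measureReal_ennreal_smul_apply, ENNReal.toReal_ofReal (hs i)])
    (by
      rw [hθmean]
      refine hmean.congr' ?_
      filter_upwards [hση] with i hi
      rw [hi.integral_id, integral_smul_measure, ENNReal.toReal_ofReal (hs i), smul_eq_mul])
    (fun t => by simpa only [put_smul _ (hs _)] using hconv t) hf hC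
  simpa only [integral_smul_measure, ENNReal.toReal_ofReal (hs _), smul_eq_mul] using key

theorem primitiveCurve_add (μhat : Measure (ℝ × ℝ)) {u v : ℝ} (h0 : 0 ≤ u) (huv : u ≤ v) :
    primitiveCurve μhat v =
      primitiveCurve μhat u + (μhat.restrict (Ioc u v ×ˢ univ)).map Prod.snd := by
  rw [primitiveCurve, primitiveCurve, ← Measure.map_add _ _ measurable_snd,
    ← Measure.restrict_union _ (measurableSet_Ioc.prod MeasurableSet.univ), ← union_prod,
    Icc_union_Ioc_eq_Icc h0 huv]
  rw [disjoint_left]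
  rintro x hx hx'
  exact absurd hx.1.2 (not_le.2 hx'.1.1)

theorem exists_primitiveCurve_add {μhat : Measure (ℝ × ℝ)} {μ : Measure ℝ}
    (h : IsLift μhat μ) (u : ℝ) : ∃ ρ, μ = primitiveCurve μhat u + ρ := by
  refine ⟨(μhat.restrict (Icc 0 u ×ˢ univ)ᶜ).map Prod.snd, ?_⟩
  rw [primitiveCurve, ← Measure.map_add _ _ measurable_snd,
    Measure.restrict_add_restrict_compl (measurableSet_Icc.prod MeasurableSet.univ), h.2]

end ShadowCoupling

/-! ### The right derivative of the shadow curve -/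

theorem mainTheorem4 (μ ν : Measure ℝ) [IsProbabilityMeasure μ] [IsProbabilityMeasure ν]
    (hμν : ShadowCoupling.ConvexLE μ ν)
    (μhat : Measure (ℝ × ℝ)) (hμhat : ShadowCoupling.IsLift μhat μ)
    (u₀ : ℝ) (hu₀ : u₀ ∈ Ico (0 : ℝ) 1) (μu₀ : Measure ℝ)
    (hderiv : ShadowCoupling.HasRightDerivative (ShadowCoupling.primitiveCurve μhat) μu₀ u₀)
    (νcurve : ℝ → Measure ℝ)
    (hνcurve : ∀ u ∈ Icc (0 : ℝ) 1,
      νcurve u = ShadowCoupling.shadow ν (ShadowCoupling.primitiveCurve μhat u))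
    (T : Set ℝ) (hT : T = (ν - νcurve u₀).support) :
    ShadowCoupling.HasRightDerivative νcurve (ShadowCoupling.hittingProjection μu₀ T) u₀ ∧
      μu₀.support ⊆ ShadowCoupling.hull T := by
  open ShadowCoupling in
  rw [hasRightDerivative_iff] at hderiv ⊢
  obtain ⟨hm, hderiv⟩ := hderiv
  have hμ := hμν.1
  have hν := hμν.2.1
  set σ : ℝ → Measure ℝ := fun u => (μhat.restrict (Ioc u₀ u ×ˢ univ)).map Prod.snd with hσdef
  have hμu : ∀ u, FiniteFirstMoment (primitiveCurve μhat u) := fun u => by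
    obtain ⟨ρ, hρ⟩ := exists_primitiveCurve_add hμhat u
    exact hμ.mono (by rw [hρ]; exact Measure.le_add_right le_rfl)
  have hadd : ∀ u, u₀ < u → primitiveCurve μhat u = primitiveCurve μhat u₀ + σ u := fun u hu =>
    primitiveCurve_add μhat hu₀.1 hu.le
  have hσ : ∀ u, u₀ < u → FiniteFirstMoment (σ u) := fun u hu =>
    (hμu u).mono (by rw [hadd u hu]; exact Measure.le_add_left le_rfl)
  have hex : ∀ u, ∃ η, u₀ < u → u ≤ 1 → νcurve u = νcurve u₀ + η ∧ η ≤ ν - νcurve u₀ ∧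
      ConvexLE (σ u) η ∧
      put η = put (ν - νcurve u₀) - envelope (put (ν - νcurve u₀) - put (σ u)) := by
    intro u
    by_cases hu : u₀ < u ∧ u ≤ 1
    · obtain ⟨ρ, hρ⟩ := exists_primitiveCurve_add hμhat u
      have hρF : FiniteFirstMoment ρ := hμ.mono (by rw [hρ]; exact Measure.le_add_left le_rfl)
      rw [hadd u hu.1] at hρ
      obtain ⟨η, h1, h2, h3, h4⟩ := exists_shadow_add (hμu u₀) (hσ u hu.1) hρF (hρ ▸ hμν)
      rw [← hadd u hu.1, ← hνcurve u ⟨hu₀.1.trans hu.1.le, hu.2⟩] at h1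
      rw [← hνcurve u₀ ⟨hu₀.1, hu₀.2.le⟩] at h1 h2 h4
      exact ⟨η, fun _ _ => ⟨h1, h2, h3, h4⟩⟩
    -- The default 0 is harmless: only `u` in (u₀, 1] matter for the limit.
    · exact ⟨0, fun h h' => absurd ⟨h, h'⟩ hu⟩
  choose η hη using hex
  have hev : ∀ᶠ u in 𝓝[>] u₀, u₀ < u ∧ u ≤ 1 := Ioc_mem_nhdsGT hu₀.2
  -- The absolute value makes the scaling factor nonnegative for every `u`; to the right of `u₀` it
  -- changes nothing.
  have hσlim : ∀ f : ℝ → ℝ, Continuous f → (∃ C : ℝ, ∀ x, |f x| ≤ C * (1 + |x|)) →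
      Tendsto (fun u => |u - u₀|⁻¹ * ∫ x, f x ∂(σ u)) (𝓝[>] u₀) (𝓝 (∫ x, f x ∂μu₀)) := by
    rintro f hf ⟨C, hC⟩
    refine (hderiv f hf ⟨C, hC⟩).congr' ?_
    filter_upwards [hev] with u hu
    rw [hadd u hu.1, integral_add_measure ((hμu u₀).integrable hf hC)
      ((hσ u hu.1).integrable hf hC), add_sub_cancel_left, abs_of_pos (sub_pos.2 hu.1)]
  have hmass : Tendsto (fun u => |u - u₀|⁻¹ * (σ u).real univ) (𝓝[>] u₀) (𝓝 (μu₀.real univ)) := by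
    have := hσlim (fun _ => 1) continuous_const ⟨1, fun x => by
      rw [abs_one]; linarith [abs_nonneg x]⟩
    simpa using this
  have hmass0 : Tendsto (fun u => (σ u).real univ) (𝓝[>] u₀) (𝓝 0) := by
    have h1 : Tendsto (fun u => |u - u₀|) (𝓝[>] u₀) (𝓝 |u₀ - u₀|) :=
      tendsto_nhdsWithin_of_tendsto_nhds (Continuous.tendsto (by fun_prop) u₀)
    have h2 := h1.mul hmass
    rw [sub_self, abs_zero, zero_mul] at h2
    refine h2.congr' ?_
    filter_upwards [hev] with u hu
    rw [mul_inv_cancel_left₀ (abs_pos.2 (sub_pos.2 hu.1).ne').ne']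
  have hput : ∀ t, Tendsto (fun u => |u - u₀|⁻¹ * put (σ u) t) (𝓝[>] u₀) (𝓝 (put μu₀ t)) :=
    fun t => hσlim _ (by fun_prop) ⟨_, linear_growth_put t⟩
  have hmean := hσlim (fun y => y) continuous_id ⟨1, fun x => by linarith⟩
  have hν' : FiniteFirstMoment (ν - νcurve u₀) := hν.sub
  have := hν'.1
  obtain ⟨hθ, hlim⟩ := tendsto_shadow_hittingProjection hν' hm (σ := σ) (η := η)
    (s := fun u => |u - u₀|⁻¹) (fun u => by positivity)
    (hev.mono fun u hu => (hη u hu.1 hu.2).2.1) (hev.mono fun u hu => (hη u hu.1 hu.2).2.2.1)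
    (hev.mono fun u hu => (hη u hu.1 hu.2).2.2.2) hmass0 hmass hmean hput
  subst hT
  refine ⟨⟨hθ, ?_⟩, ?_⟩
  · rintro f hf ⟨C, hC⟩
    refine (hlim f hf ⟨C, hC⟩).congr' ?_
    filter_upwards [hev] with u hu
    obtain ⟨h1, h2, h3, -⟩ := hη u hu.1 hu.2
    have hν₀ : FiniteFirstMoment (νcurve u₀) := by
      obtain ⟨ρ, hρ⟩ := exists_primitiveCurve_add hμhat u₀
      have hρF : FiniteFirstMoment ρ := hμ.mono (by rw [hρ]; exact Measure.le_add_left le_rfl)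
      rw [hνcurve u₀ ⟨hu₀.1, hu₀.2.le⟩]
      exact (isShadow_shadow (hμu u₀) hρF (hρ ▸ hμν)).1.convexLE.2.1
    rw [h1, integral_add_measure (hν₀.integrable hf hC) (h3.2.1.integrable hf hC),
      add_sub_cancel_left, abs_of_pos (sub_pos.2 hu.1)]
  -- The increment `η u`, being below the remainder, is carried by its support. So puts left of the
  -- hull and calls right of it vanish for `η u`, hence for `σ u`, and in the limit for `μu₀`.
  · refine support_subset_hull hm (fun t ht => ?_) (fun t ht => ?_)
    · refine tendsto_nhds_unique (hput t) (tendsto_const_nhds.congr' ?_)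
      filter_upwards [hev] with u hu
      obtain ⟨-, h2, h3, -⟩ := hη u hu.1 hu.2
      rw [← h3.put_eq_of_notMem (ae_mem_of_le h2) (Or.inl ht),
        put_eq_zero_of_le_einf (ae_mem_of_le h2) ht, mul_zero]
    · rw [integral_call hm]
      refine tendsto_nhds_unique
        ((hput t).sub ((hmass.mul_const t).sub hmean)) (tendsto_const_nhds.congr' ?_)
      filter_upwards [hev] with u hu
      obtain ⟨-, h2, h3, -⟩ := hη u hu.1 hu.2
      have h4 := integral_call_eq_zero_of_esup_le (ae_mem_of_le h2) ht
      rw [integral_call h3.2.1, ← h3.measureReal_univ, ← h3.integral_id,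
        h3.put_eq_of_notMem (ae_mem_of_le h2) (Or.inr ht)] at h4
      linear_combination -(|u - u₀|⁻¹) * h4
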